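/- Distance bounds for the Majorana color code. Let $\Sigma=S^1\times[0,1]$ be a cylinder with a metric (inducing its topology) such that both boundary circles $S^1\times\{0\}$, $S^1\times\{1\}$ have length $R$, the distance between them is $L$, and every non-contractible closed curve in $\Sigma$ has length at least $R$ (for example, the flat cylinder of circumference $R$ and height $L$). Let $G\subseteq\Sigma$ be a finite graph that contains both boundary circles and induces a cellular decomposition of $\Sigma$ in which every closed face is an embedded disc, and suppose that: (G1) the number $|V|$ of vertices is even; (G2) every vertex has degree $3$; (G3) the boundary of every face has even length (number of edges); (G4) each of the two boundary circles of $\Sigma$ has odd length (number of edges). Place a Majorana mode $c_u$ at every vertex $u$, with $c_uc_v+c_vc_u=2\delta_{u,v}I$. Majorana operators are the elements of the group generated by the $c_u$ and $iI$; each has the form $\eta\, c_A$ with $\eta\in\{\pm1,\pm i\}$ and $c_A=\prod_{u\in A}c_u$ (product in a fixed order of the vertices); $A\subseteq V$ is its support, $|A|$ its weight, and it is even if $|A|$ is even. For a face $f$ put $C_f=\prod_{u\in V(f)}c_u$, where $V(f)$ is the set of vertices on the boundary of $f$. A Majorana color code of $G$ is a group $\mathcal S=\langle \eta_f C_f : f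 \text{ a face}\rangle$, with phases $\eta_f\in\{\pm1,\pm i\}$ chosen such that $\mathcal S$ is abelian, does not contain $-I$, and consists of even operators. A logical operator is a Majorana operator that commutes with all elements of $\mathcal S$ and is not a phase times an element of $\mathcal S$. Let $d$ be the minimum weight of a logical operator, and $l_{\rm even}$ the minimum diameter (in the metric of $\Sigma$) of the support of an even logical operator. If all edges of $G$ have length $O(1)$ and every face has $O(1)$ edges, then $$d=\Omega(\min(R,L)),\qquad l_{\rm even}=\Omega(L).$$ That is, for all $\ell$ and $k$ there is a constant $c>0$, depending only on $\ell$ and $k$, such that whenever all edges of $G$ have length at most $\ell$ and every face has at most $k$ edges, every Majorana color code of $G$ satisfies $d\ge c\min(R,L)$ and $l_{\rm even}\ge c\,L$. -/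

import Mathlib

open scoped ENNReal

noncomputable section

/-! ### Majorana operators and Majorana fermion codes -/

section Majorana

variable (V : Type*) [Fintype V]

/-- The complex quadratic form `∑ u, x u ^ 2`. -/
abbrev majoranaForm : QuadraticForm ℂ (V → ℂ) :=
  QuadraticMap.weightedSumSquares ℂ (fun _ : V => (1 : ℂ))

/-- The complex algebra generated by one Majorana mode `c u` for each `u : V`, subject to
`c u * c v + c v * c u = 2 δ_{u v}` (for an even number `2 n` of modes it is the algebra of all
operators on the `2 ^ n`-dimensional Fock space). -/
abbrev MajoranaAlgebra : Type _ := CliffordAlgebra (majoranaForm V)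

variable {V} [LinearOrder V]

/-- The single-mode operator `c u`. -/
def majoranaMode (u : V) : MajoranaAlgebra V :=
  CliffordAlgebra.ι (majoranaForm V) (Pi.single u 1)

theorem majoranaMode_mul_self (u : V) : majoranaMode u * majoranaMode u = 1 := by
  rw [majoranaMode, CliffordAlgebra.ι_sq_scalar]
  simp [QuadraticMap.weightedSumSquares_apply, Pi.single_apply]

theorem majoranaMode_anticomm {u v : V} (h : u ≠ v) :
    majoranaMode u * majoranaMode v + majoranaMode v * majoranaMode u = 0 := by
  rw [majoranaMode, majoranaMode, CliffordAlgebra.ι_mul_ι_add_swap]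
  have : QuadraticMap.polar (majoranaForm V) (Pi.single u 1) (Pi.single v 1) = 0 := by
    simp only [QuadraticMap.polar, QuadraticMap.weightedSumSquares_apply, Pi.add_apply,
      ← Finset.sum_sub_distrib]
    refine Finset.sum_eq_zero fun i _ => ?_
    by_cases hu : i = u <;> by_cases hv : i = v <;> simp_all
  rw [this, map_zero]

/-- The mode `c u` as an invertible element. -/
def majoranaUnit (u : V) : (MajoranaAlgebra V)ˣ where
  val := majoranaMode u
  inv := majoranaMode u
  val_inv := majoranaMode_mul_self u
  inv_val := majoranaMode_mul_self u

/-- The scalar operator `i I`. -/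
def imaginaryUnit : (MajoranaAlgebra V)ˣ :=
  Units.map (algebraMap ℂ (MajoranaAlgebra V)).toMonoidHom (Units.mk0 Complex.I Complex.I_ne_zero)

variable (V) in
/-- The group of Majorana operators, generated by the single-mode operators and by `i I`. -/
def majoranaGroup : Subgroup (MajoranaAlgebra V)ˣ :=
  Subgroup.closure (insert imaginaryUnit (Set.range majoranaUnit))

/-- `c_A`, the product of the modes in `A` in increasing order. -/
def majoranaMonomial (A : Finset V) : MajoranaAlgebra V :=
  (A.sort.map majoranaMode).prod

/-- A phase factor: one of `1, -1, i, -i`. -/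
def IsPhase (η : ℂ) : Prop := η ∈ ({1, -1, Complex.I, -Complex.I} : Set ℂ)

/-- `P = η c_A` for a phase factor `η`, that is, `A` is the support of `P`. -/
def HasSupport (P : (MajoranaAlgebra V)ˣ) (A : Finset V) : Prop :=
  ∃ η : ℂ, IsPhase η ∧ (P : MajoranaAlgebra V) = η • majoranaMonomial A

/-- `S` is (the stabilizer group of) a Majorana fermion code: an abelian group of Majorana
operators of even weight that does not contain `-I`. -/
structure IsMajoranaCode (S : Subgroup (MajoranaAlgebra V)ˣ) : Prop where
  le_group : S ≤ majoranaGroup V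
  comm : ∀ P ∈ S, ∀ Q ∈ S, P * Q = Q * P
  neg_one_notMem : (-1 : (MajoranaAlgebra V)ˣ) ∉ S
  even : ∀ P ∈ S, ∀ A, HasSupport P A → Even A.card

/-- The centralizer of `S` in the group of Majorana operators. -/
def codeCentralizer (S : Subgroup (MajoranaAlgebra V)ˣ) : Subgroup (MajoranaAlgebra V)ˣ :=
  majoranaGroup V ⊓ Subgroup.centralizer (S : Set (MajoranaAlgebra V)ˣ)

/-- Logical operators: elements of the centralizer that are not in `S` up to a phase factor
(without "up to a phase factor" the scalar `i I` would be a logical operator of weight zero). -/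
def IsLogical (S : Subgroup (MajoranaAlgebra V)ˣ) (P : (MajoranaAlgebra V)ˣ) : Prop :=
  P ∈ codeCentralizer S ∧
    ¬ ∃ Q ∈ S, ∃ η : ℂ, IsPhase η ∧ (P : MajoranaAlgebra V) = η • (Q : MajoranaAlgebra V)

/-- The distance: the minimum weight of a logical operator. -/
def codeDistance (S : Subgroup (MajoranaAlgebra V)ˣ) : ℕ :=
  sInf {w | ∃ P A, IsLogical S P ∧ HasSupport P A ∧ w = A.card}

/-- The minimum diameter of the support of an even logical operator, where the mode `u` sits at
the point `pos u` of a metric space. -/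
def evenDiameter {X : Type*} [MetricSpace X] (pos : V → X)
    (S : Subgroup (MajoranaAlgebra V)ˣ) : ℝ :=
  sInf {r | ∃ P A, IsLogical S P ∧ HasSupport P A ∧ Even A.card ∧
    r = Metric.diam (pos '' (A : Set V))}

end Majorana

/-! ### Metric cylinders -/

/-- The topological cylinder `S¹ × [0,1]`. -/
abbrev Cylinder : Type := UnitAddCircle × unitInterval

/-- The heights `0` and `1` of the two boundary circles `S¹ × {0}` and `S¹ × {1}`. -/
def boundaryLevel (i : Fin 2) : unitInterval := if i = 0 then 0 else 1

/-- The length of a parametrized curve in a metric space. -/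
def curveLength {X : Type*} [MetricSpace X] (γ : unitInterval → X) : ℝ≥0∞ :=
  eVariationOn γ Set.univ

/-- A metric on the cylinder, given as a metric space `X` with a homeomorphism `Φ` onto
`S¹ × [0,1]`. Both boundary circles have length `R`, they are at distance `L`, and closed curves
that wind around the cylinder (i.e. are not contractible) are not shorter than `R`. -/
structure IsMetricCylinder {X : Type*} [MetricSpace X] (Φ : X ≃ₜ Cylinder) (R L : ℝ) : Prop where
  boundary_length : ∀ i : Fin 2,
    curveLength (fun t : unitInterval => Φ.symm (((t : ℝ) : UnitAddCircle), boundaryLevel i)) =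
      ENNReal.ofReal R
  height : IsLeast {r : ℝ | ∃ x y : X, (Φ x).2 = boundaryLevel 0 ∧ (Φ y).2 = boundaryLevel 1 ∧
    r = dist x y} L
  girth : ∀ (x : X) (γ : Path x x), ¬ γ.Homotopic (Path.refl x) →
    ENNReal.ofReal R ≤ curveLength γ

/-! ### Graphs embedded in the cylinder -/

/-- A finite graph embedded in the cylinder `X` that induces a cellular decomposition of `X`, with
vertices `V`, directed edges `D` (each edge carries two opposite directions) and faces `F`.
Patching the two holes of the cylinder adds two external faces `inr 0` and `inr 1`; then every
directed edge has exactly one face on its left. Several edges may join the same two vertices. -/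
structure CellDecomposition {X : Type*} [TopologicalSpace X] (Φ : X ≃ₜ Cylinder)
    (V D F : Type*) [Fintype D] where
  /-- the starting vertex of a directed edge -/
  tail : D → V
  /-- reversal of direction -/
  rev : Equiv.Perm D
  rev_rev : ∀ d, rev (rev d) = d
  rev_ne : ∀ d, rev d ≠ d
  /-- the directed edge that follows `d` in the boundary walk of the face to the left of `d` -/
  next : Equiv.Perm D
  /-- the face (internal or external) to the left of a directed edge -/
  left : D → F ⊕ Fin 2
  /-- the directed edges around one face form a single boundary walk -/
  left_eq_iff : ∀ d d', left d = left d' ↔ next.SameCycle d d'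
  /-- the directed edges leaving one vertex form a single cycle of rotations about it -/
  tail_eq_iff : ∀ d d', tail d = tail d' ↔ (next * rev).SameCycle d d'
  /-- the point at which a vertex is placed -/
  pos : V → X
  pos_injective : Function.Injective pos
  /-- the curve along which an edge is drawn -/
  curve : D → C(unitInterval, X)
  curve_zero : ∀ d, curve d 0 = pos (tail d)
  curve_rev : ∀ d t, curve (rev d) t = curve d (unitInterval.symm t)
  /-- edges are simple and meet neither each other nor the vertices except at their ends -/
  curve_injective : ∀ d d', ∀ t ∈ Set.Ioo (0 : unitInterval) 1, ∀ s ∈ Set.Ioo (0 : unitInterval) 1,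
    curve d t = curve d' s → (d' = d ∧ s = t) ∨ (d' = rev d ∧ s = unitInterval.symm t)
  curve_ne_pos : ∀ d, ∀ t ∈ Set.Ioo (0 : unitInterval) 1, ∀ v, curve d t ≠ pos v
  /-- the boundary circles of the cylinder consist of the edges next to the external faces -/
  boundary_eq : ∀ i : Fin 2, {x | (Φ x).2 = boundaryLevel i} =
    ⋃ d ∈ {d | left d = Sum.inr i}, Set.range (curve d)
  /-- a parametrization of each closed face by the closed unit disc -/
  cell : F → ℂ → X
  cell_continuousOn : ∀ f, ContinuousOn (cell f) (Metric.closedBall 0 1)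
  /-- closed faces are embedded discs: a boundary walk does not touch itself -/
  cell_injOn : ∀ f, Set.InjOn (cell f) (Metric.closedBall 0 1)
  /-- the directed edge at which the boundary walk of a face starts -/
  base : F → D
  left_base : ∀ f, left (base f) = Sum.inl f
  /-- the unit circle is mapped to the boundary walk of the face, one equal arc for each edge -/
  cell_boundary : ∀ (f : F) (j : ℕ) (t : unitInterval),
    cell f (Complex.exp (2 * Real.pi * Complex.I *
      ((j + ((t : ℝ) : ℂ)) / (Nat.card {d // left d = Sum.inl f} : ℂ)))) =
      curve ((next ^ j) (base f)) t
  /-- open faces meet neither the graph nor each other -/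
  cell_ne_curve : ∀ f, ∀ z ∈ Metric.ball (0 : ℂ) 1, ∀ d t, cell f z ≠ curve d t
  cell_disjoint : ∀ f g, ∀ z ∈ Metric.ball (0 : ℂ) 1, ∀ w ∈ Metric.ball (0 : ℂ) 1,
    cell f z = cell g w → f = g
  /-- the closed faces cover the cylinder -/
  cell_cover : ∀ x, ∃ f, ∃ z ∈ Metric.closedBall (0 : ℂ) 1, cell f z = x

namespace CellDecomposition

section

variable {X : Type*} [TopologicalSpace X] {Φ : X ≃ₜ Cylinder} {V D F : Type*}
  [Fintype V] [Fintype D] (G : CellDecomposition Φ V D F)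

/-- The number of edges in the boundary of a (possibly external) face. -/
def boundaryCount (f : F ⊕ Fin 2) : ℕ := Nat.card {d // G.left d = f}

open Classical in
/-- The set of vertices on the boundary of the face `f`. -/
def faceVertices (f : F) : Finset V :=
  Finset.univ.filter fun u => ∃ d, G.tail d = u ∧ G.left d = Sum.inl f

/-- The four conditions on the graph: an even number of vertices, all of degree three; face
boundaries of even length; boundary circles of odd length. -/
structure IsAdmissible : Prop where
  even_vertices : Even (Fintype.card V)
  trivalent : ∀ u, Nat.card {d // G.tail d = u} = 3
  even_faces : ∀ f : F, Even (G.boundaryCount (Sum.inl f))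
  odd_boundary : ∀ i : Fin 2, Odd (G.boundaryCount (Sum.inr i))

/-- `S` is a Majorana color code of `G`: a Majorana fermion code generated by the face operators
`η_f C_f`, where `C_f` is the product of the modes on the boundary of `f` and the `η_f` are phase
factors. -/
def IsColorCode [LinearOrder V] (S : Subgroup (MajoranaAlgebra V)ˣ) : Prop :=
  IsMajoranaCode S ∧ ∃ C : F → (MajoranaAlgebra V)ˣ,
    (∀ f, HasSupport (C f) (G.faceVertices f)) ∧ S = Subgroup.closure (Set.range C)

end

end CellDecomposition

end

/-!
Write the code in terms of the incidence of vertices with the faces of the patched sphere, modulo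
two. For a set `x` of faces let `vertexSum x` be the set of vertices with an odd number of corners
in `x`; for a set `B` of vertices let `faceSum B` record the parities of its overlaps with the
faces. An operator with support `A` commutes with the code iff `faceSum A` vanishes on the internal
faces, and products of face operators have the supports `vertexSum x` with `x` internal.

Two facts determine the logical operators. First, `faceSum (vertexSum x) g = |g| x g`
(`faceSum_vertexSum`), so by the parity conditions `faceSum` recovers the values of `x` on the two
external faces. Second, `|V| ≤ 2 |F|` (`card_vertices_le`). Together with connectedness, a dimension
count then shows that every `A` commuting with the code is `vertexSum x` for some `x`
(`exists_vertexSum_eq`). It is logical only if `x` contains an external face, and `|A|` has the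
parity of the number of external faces in `x`. Hence an even logical operator overlaps oddly with
both boundary circles, so its diameter is at least `L`. The total parity `c_V` is such an operator
(`exists_isLogical_univ`), so the minima are taken over nonempty sets.

For the weight, decompose a support into clusters of vertices that share faces. The clusters meeting
the first boundary circle either reach the second one, which takes weight of order `L`, or form an
odd set (`min_le_of_odd_boundary_overlap`). An odd set has weight of order `R`: the dimension count
also yields a set of faces containing two of the three faces at every vertex (two of the three
colours, in terms of local colourings), and if all closed walks of length of order `|A|` are even,
one of these two can be selected at the vertices of `A` consistently, which writes `|A|` as a sum of
even overlaps (`even_card_of_short_closed_walks_even`). So there is a short odd closed walk, and odd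
closed walks have length at least `R` because they wind around the cylinder.

The topology enters through double covers. A cochain modulo two on the edges that vanishes around
every internal face defines a double cover of the cylinder, glued from trivial covers of the open
stars of the vertices (`doubleCover`), which has sections over maps from simply connected spaces
(`exists_isSheet`). Applied to the constant cochain `1` and a null homotopy, this shows that closed
walks which are contractible are even. Applied to the universal cover of the cylinder, it shows that
up to a one-dimensional space every cocycle is a coboundary (`exists_cocycle_generator`), which is
the bound on the genus behind `|V| ≤ 2 |F|`.
-/

noncomputable section

/-! ### Products of Majorana modes -/

section MajoranaProducts

variable {V : Type*} [Fintype V] [LinearOrder V]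

theorem IsPhase.mul {a b : ℂ} (ha : IsPhase a) (hb : IsPhase b) : IsPhase (a * b) := by
  simp only [IsPhase, Set.mem_insert_iff, Set.mem_singleton_iff] at *
  rcases ha with rfl | rfl | rfl | rfl <;> rcases hb with rfl | rfl | rfl | rfl <;> simp

theorem IsPhase.inv {a : ℂ} (ha : IsPhase a) : IsPhase a⁻¹ := by
  simp only [IsPhase, Set.mem_insert_iff, Set.mem_singleton_iff] at *
  rcases ha with rfl | rfl | rfl | rfl <;> simp

theorem IsPhase.ne_zero {a : ℂ} (ha : IsPhase a) : a ≠ 0 := by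
  rintro rfl
  simp [IsPhase, eq_comm] at ha

theorem isPhase_one : IsPhase 1 := by simp [IsPhase]

theorem isPhase_neg_one : IsPhase (-1) := by simp [IsPhase]

/-- Reordering a product of distinct modes changes it at most by a sign. -/
theorem exists_isPhase_prod_eq_of_perm {l m : List V} (h : l.Perm m) (hl : l.Nodup) :
    ∃ η : ℂ, IsPhase η ∧ (l.map majoranaMode).prod = η • (m.map majoranaMode).prod := by
  induction h with
  | nil => exact ⟨1, isPhase_one, by simp⟩
  | cons u _ ih =>
    obtain ⟨η, hη, e⟩ := ih (List.nodup_cons.1 hl).2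
    exact ⟨η, hη, by simp [e]⟩
  | swap u v l =>
    refine ⟨-1, isPhase_neg_one, ?_⟩
    have huv : v ≠ u := by
      simp only [List.nodup_cons, List.mem_cons, not_or] at hl
      exact hl.1.1
    have := eq_neg_of_add_eq_zero_left (majoranaMode_anticomm huv)
    simp [← mul_assoc, this]
  | trans h₁ _ ih₁ ih₂ =>
    obtain ⟨η, hη, e⟩ := ih₁ hl
    obtain ⟨θ, hθ, e'⟩ := ih₂ (h₁.nodup_iff.1 hl)
    exact ⟨η * θ, hη.mul hθ, by rw [e, e', smul_smul]⟩

theorem exists_isPhase_mode_mul_monomial (u : V) (A : Finset V) :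
    ∃ η : ℂ, IsPhase η ∧
      majoranaMode u * majoranaMonomial A = η • majoranaMonomial (symmDiff {u} A) := by
  by_cases hu : u ∈ A
  · have hs : symmDiff {u} A = A.erase u := by
      ext v; by_cases hv : v = u <;> simp [Finset.mem_symmDiff, hv, hu]
    have hp : A.sort.Perm (u :: (A.erase u).sort) := by
      rw [← Multiset.coe_eq_coe, ← Multiset.cons_coe, Finset.sort_eq, Finset.sort_eq,
        ← Finset.insert_val_of_notMem (Finset.notMem_erase u A), Finset.insert_erase hu]
    obtain ⟨η, hη, e⟩ := exists_isPhase_prod_eq_of_perm hp (Finset.sort_nodup _ _)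
    refine ⟨η, hη, ?_⟩
    rw [hs, majoranaMonomial, majoranaMonomial, e, List.map_cons, List.prod_cons,
      mul_smul_comm, ← mul_assoc, majoranaMode_mul_self, one_mul]
  · have hs : symmDiff {u} A = insert u A := by
      ext v; by_cases hv : v = u <;> simp [Finset.mem_symmDiff, hv, hu]
    have hp : (u :: A.sort).Perm (insert u A).sort := by
      rw [← Multiset.coe_eq_coe, ← Multiset.cons_coe, Finset.sort_eq, Finset.sort_eq,
        ← Finset.insert_val_of_notMem hu]
    obtain ⟨η, hη, e⟩ := exists_isPhase_prod_eq_of_perm hp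
      (List.nodup_cons.2 ⟨by simpa using hu, Finset.sort_nodup _ _⟩)
    exact ⟨η, hη, by rw [hs, majoranaMonomial, majoranaMonomial, ← e, List.map_cons,
      List.prod_cons]⟩

theorem exists_isPhase_list_prod_mul_monomial (l : List V) (B : Finset V) (hl : l.Nodup) :
    ∃ η : ℂ, IsPhase η ∧ (l.map majoranaMode).prod * majoranaMonomial B =
      η • majoranaMonomial (symmDiff l.toFinset B) := by
  induction l with
  | nil => exact ⟨1, isPhase_one, by simp [← Finset.bot_eq_empty]⟩
  | cons u l ih =>
    rw [List.nodup_cons] at hl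
    obtain ⟨η, hη, e⟩ := ih hl.2
    obtain ⟨θ, hθ, e'⟩ := exists_isPhase_mode_mul_monomial u (symmDiff l.toFinset B)
    refine ⟨η * θ, hη.mul hθ, ?_⟩
    have hs : symmDiff {u} l.toFinset = insert u l.toFinset := by
      ext v
      by_cases hv : v = u
      · subst hv; simp [Finset.mem_symmDiff, hl.1]
      · simp [Finset.mem_symmDiff, hv]
    rw [List.map_cons, List.prod_cons, mul_assoc, e, mul_smul_comm, e', smul_smul,
      ← symmDiff_assoc, hs, List.toFinset_cons]

/-- Supports of Majorana operators add modulo two. -/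
theorem HasSupport.mul {P Q : (MajoranaAlgebra V)ˣ} {A B : Finset V} (hP : HasSupport P A)
    (hQ : HasSupport Q B) : HasSupport (P * Q) (symmDiff A B) := by
  obtain ⟨η, hη, e⟩ := hP
  obtain ⟨θ, hθ, e'⟩ := hQ
  obtain ⟨ζ, hζ, e''⟩ := exists_isPhase_list_prod_mul_monomial A.sort B (Finset.sort_nodup _ _)
  refine ⟨η * θ * ζ, (hη.mul hθ).mul hζ, ?_⟩
  rw [Finset.sort_toFinset] at e''
  rw [Units.val_mul, e, e', smul_mul_smul_comm, majoranaMonomial, e'', smul_smul]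

theorem hasSupport_one : HasSupport (1 : (MajoranaAlgebra V)ˣ) ∅ :=
  ⟨1, isPhase_one, by simp [majoranaMonomial]⟩

theorem mode_mul_list_prod (u : V) (l : List V) :
    majoranaMode u * (l.map majoranaMode).prod =
      (-1 : ℂ) ^ (l.length + l.count u) • ((l.map majoranaMode).prod * majoranaMode u) := by
  induction l with
  | nil => simp
  | cons v l ih =>
    rw [List.map_cons, List.prod_cons, List.length_cons]
    by_cases h : v = u
    · subst h
      rw [mul_assoc, ih, List.count_cons_self, mul_smul_comm]
      congr 1
      ring
    · have hc := eq_neg_of_add_eq_zero_left (majoranaMode_anticomm (Ne.symm h))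
      rw [← mul_assoc, hc, neg_mul, mul_assoc, ih, List.count_cons_of_ne h,
        mul_smul_comm, mul_assoc, ← neg_smul]
      congr 1
      ring

theorem list_prod_mul_list_prod (l m : List V) :
    (l.map majoranaMode).prod * (m.map majoranaMode).prod =
      (-1 : ℂ) ^ (l.map fun u => m.length + m.count u).sum •
        ((m.map majoranaMode).prod * (l.map majoranaMode).prod) := by
  induction l with
  | nil => simp
  | cons u l ih =>
    rw [List.map_cons, List.prod_cons, mul_assoc, ih, mul_smul_comm, ← mul_assoc,
      mode_mul_list_prod, List.map_cons, List.sum_cons, smul_mul_assoc, smul_smul, mul_assoc]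
    congr 1
    ring

theorem monomial_mul_monomial_comm (A B : Finset V) :
    majoranaMonomial A * majoranaMonomial B =
      (-1 : ℂ) ^ (A.card * B.card + (A ∩ B).card) •
        (majoranaMonomial B * majoranaMonomial A) := by
  rw [majoranaMonomial, majoranaMonomial, list_prod_mul_list_prod]
  congr 2
  have h : ∀ u, B.sort.count u = if u ∈ B then 1 else 0 := by
    intro u
    rw [List.Nodup.count (Finset.sort_nodup _ _)]
    simp
  have h2 : (A.sort.map fun u => B.sort.length + B.sort.count u).sum =
      ∑ u ∈ A, (B.card + if u ∈ B then 1 else 0) := by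
    rw [Finset.sum_eq_multiset_sum, ← Finset.sort_eq A (· ≤ ·), Multiset.map_coe,
      Multiset.sum_coe]
    simp [h]
  rw [h2, Finset.sum_add_distrib, Finset.sum_const, smul_eq_mul, Finset.sum_ite_mem,
    Finset.sum_const, smul_eq_mul, mul_one]

theorem majoranaAlgebra_nontrivial (V : Type*) [Fintype V] : Nontrivial (MajoranaAlgebra V) :=
  letI : Invertible (2 : ℂ) := invertibleOfNonzero two_ne_zero
  inferInstance

omit [LinearOrder V] in
theorem majoranaUnits_ne_neg (P : (MajoranaAlgebra V)ˣ) :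
    (P : MajoranaAlgebra V) ≠ -(P : MajoranaAlgebra V) := by
  have := majoranaAlgebra_nontrivial V
  intro h
  have h2 : (2 : ℂ) • (P : MajoranaAlgebra V) = 0 := by
    rw [two_smul]
    nth_rewrite 2 [h]
    exact add_neg_cancel _
  exact P.ne_zero ((smul_eq_zero.1 h2).resolve_left two_ne_zero)

/-- If one of the supports is even, operators commute exactly when the overlap is even. -/
theorem HasSupport.commute_iff {P Q : (MajoranaAlgebra V)ˣ} {A B : Finset V}
    (hP : HasSupport P A) (hQ : HasSupport Q B) (hB : Even B.card) :
    P * Q = Q * P ↔ Even (A ∩ B).card := by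
  have key : (P * Q : MajoranaAlgebra V) = (-1 : ℂ) ^ (A ∩ B).card • (Q * P) := by
    obtain ⟨η, _, e⟩ := hP
    obtain ⟨θ, _, e'⟩ := hQ
    rw [e, e', smul_mul_smul_comm, monomial_mul_monomial_comm, pow_add,
      (hB.mul_left _).neg_one_pow, one_mul, smul_mul_smul_comm, smul_smul, smul_smul, mul_comm,
      mul_comm θ]
  rw [Units.ext_iff, Units.val_mul, Units.val_mul, key]
  rcases Nat.even_or_odd (A ∩ B).card with h | h
  · simp [h.neg_one_pow, h]
  · have := majoranaUnits_ne_neg (Q * P)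
    rw [Units.val_mul] at this
    simp [h.neg_one_pow, Nat.not_even_iff_odd.2 h, this.symm]

theorem exists_mem_majoranaGroup_hasSupport (A : Finset V) :
    ∃ P ∈ majoranaGroup V, HasSupport P A := by
  refine ⟨(A.sort.map majoranaUnit).prod, ?_, 1, isPhase_one, ?_⟩
  · refine Subgroup.list_prod_mem _ fun Q hQ => ?_
    obtain ⟨u, _, rfl⟩ := List.mem_map.1 hQ
    exact Subgroup.subset_closure (Or.inr ⟨u, rfl⟩)
  · rw [one_smul, majoranaMonomial, ← Units.coeHom_apply, map_list_prod, List.map_map]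
    rfl

/-- Operators with the same support agree up to a phase. -/
theorem HasSupport.exists_isPhase_eq_smul {P Q : (MajoranaAlgebra V)ˣ} {A : Finset V}
    (hP : HasSupport P A) (hQ : HasSupport Q A) :
    ∃ η : ℂ, IsPhase η ∧ (P : MajoranaAlgebra V) = η • (Q : MajoranaAlgebra V) := by
  obtain ⟨η, hη, e⟩ := hP
  obtain ⟨θ, hθ, e'⟩ := hQ
  exact ⟨η * θ⁻¹, hη.mul hθ.inv, by
    rw [e, e', smul_smul, inv_mul_cancel_right₀ hθ.ne_zero]⟩

end MajoranaProducts

/-! ### Functions on the cycles of a permutation -/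

section Cycles

variable {α : Type*} {σ : Equiv.Perm α} {s : Finset α}

theorem sum_range_pow_of_isCycleOn {M : Type*} [AddCommMonoid M] (hσ : σ.IsCycleOn (s : Set α))
    {b : α} (hb : b ∈ s) (h : α → M) : ∑ i ∈ Finset.range s.card, h ((σ ^ i) b) = ∑ a ∈ s, h a := by
  refine Finset.sum_nbij (fun i => (σ ^ i) b) ?_ ?_ ?_ (fun _ _ => rfl)
  · intro i _
    exact hσ.1.mapsTo.perm_pow i hb
  · intro i hi j hj hij
    have := (hσ.pow_apply_eq_pow_apply hb).1 hij
    exact this.eq_of_lt_of_lt (Finset.mem_range.1 hi) (Finset.mem_range.1 hj)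
  · intro a ha
    obtain ⟨n, hn, rfl⟩ := hσ.exists_pow_eq hb ha
    exact ⟨n, Finset.mem_coe.2 (Finset.mem_range.2 hn), rfl⟩

/-- A function with vanishing sum over a cycle is the difference of a potential along it. -/
theorem exists_potential_of_isCycleOn {M : Type*} [AddCommGroup M] (hσ : σ.IsCycleOn (s : Set α))
    {b : α} (hb : b ∈ s) (p : α → M) (hp : ∑ a ∈ s, p a = 0) :
    ∃ ψ : α → M, ∀ a ∈ s, ψ (σ a) = ψ a + p a := by
  classical
  have hex : ∀ a ∈ s, ∃ n < s.card, (σ ^ n) b = a := fun a ha => hσ.exists_pow_eq hb ha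
  choose! n hn hna using hex
  refine ⟨fun a => ∑ i ∈ Finset.range (n a), p ((σ ^ i) b), fun a ha => ?_⟩
  have hσa : σ a ∈ s := hσ.1.mapsTo ha
  have e1 : (σ ^ (n (σ a))) b = (σ ^ (n a + 1)) b := by
    rw [hna _ hσa, pow_succ', Equiv.Perm.mul_apply, hna _ ha]
  have hmod := (hσ.pow_apply_eq_pow_apply hb).1 e1
  have e2 : (∑ i ∈ Finset.range (n a), p ((σ ^ i) b)) + p a =
      ∑ i ∈ Finset.range (n a + 1), p ((σ ^ i) b) := by
    rw [Finset.sum_range_succ, hna _ ha]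
  rw [e2]
  beta_reduce
  rcases Nat.lt_or_ge (n a + 1) s.card with h | h
  · rw [hmod.eq_of_lt_of_lt (hn _ hσa) h]
  · have hc : n a + 1 = s.card := le_antisymm (hn _ ha) h
    have h0 : n (σ a) = 0 := by
      rw [hc] at hmod
      exact Nat.eq_zero_of_dvd_of_lt ((Nat.modEq_zero_iff_dvd).1 (hmod.trans (by simp [Nat.ModEq])))
        (hn _ hσa)
    rw [h0, hc, sum_range_pow_of_isCycleOn hσ hb, hp, Finset.sum_range_zero]

end Cycles

/-! ### Corners, faces and vertices -/

namespace CellDecomposition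

section Combinatorics

open scoped Classical

variable {X : Type*} [TopologicalSpace X] {Φ : X ≃ₜ Cylinder} {V D F : Type*}
  [Fintype D] (G : CellDecomposition Φ V D F)

/-- Rotation about the starting vertex: the directed edge that follows `d` among those leaving
the vertex `tail d`. The directed edge `d` also stands for the corner between `d` and its
predecessor, which belongs to the face to the left of `d`. -/
def rot : Equiv.Perm D := G.next * G.rev

theorem rot_apply (d : D) : G.rot d = G.next (G.rev d) := rfl

theorem left_next (d : D) : G.left (G.next d) = G.left d :=
  (G.left_eq_iff _ _).2 (Equiv.Perm.sameCycle_apply_left.2 (Equiv.Perm.SameCycle.refl _ _))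

theorem tail_rot (d : D) : G.tail (G.rot d) = G.tail d :=
  (G.tail_eq_iff _ _).2 (Equiv.Perm.sameCycle_apply_left.2 (Equiv.Perm.SameCycle.refl _ _))

theorem left_rot (d : D) : G.left (G.rot d) = G.left (G.rev d) := G.left_next _

theorem rot_rev (d : D) : G.rot (G.rev d) = G.next d := by rw [rot_apply, G.rev_rev]

theorem tail_next (d : D) : G.tail (G.next d) = G.tail (G.rev d) := by
  rw [← G.rot_rev, G.tail_rot]

theorem curve_one (d : D) : G.curve d 1 = G.pos (G.tail (G.rev d)) := by
  have := G.curve_rev d 0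
  rw [unitInterval.symm_zero] at this
  rw [← this, G.curve_zero]

/-- The corners at a vertex. -/
def cornersAt (v : V) : Finset D := {d | G.tail d = v}

/-- The corners of a (possibly external) face. -/
def cornersOf (g : F ⊕ Fin 2) : Finset D := {d | G.left d = g}

@[simp] theorem mem_cornersAt {v : V} {d : D} : d ∈ G.cornersAt v ↔ G.tail d = v := by
  simp [cornersAt]

@[simp] theorem mem_cornersOf {g : F ⊕ Fin 2} {d : D} : d ∈ G.cornersOf g ↔ G.left d = g := by
  simp [cornersOf]

theorem card_cornersOf (g : F ⊕ Fin 2) : (G.cornersOf g).card = G.boundaryCount g := by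
  rw [boundaryCount, Nat.card_eq_fintype_card, Fintype.card_subtype, cornersOf]

theorem isCycleOn_rot (v : V) : G.rot.IsCycleOn (G.cornersAt v : Set D) := by
  refine ⟨⟨fun d hd => ?_, G.rot.injective.injOn, fun d hd => ⟨G.rot.symm d, ?_, by simp⟩⟩,
    fun d hd e he => ?_⟩
  · simpa [G.tail_rot] using hd
  · have := G.tail_rot (G.rot.symm d)
    rw [Equiv.apply_symm_apply] at this
    simpa [← this] using hd
  · simp only [Finset.mem_coe, mem_cornersAt] at hd he
    exact (G.tail_eq_iff d e).1 (hd.trans he.symm)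

theorem isCycleOn_next (g : F ⊕ Fin 2) : G.next.IsCycleOn (G.cornersOf g : Set D) := by
  refine ⟨⟨fun d hd => ?_, G.next.injective.injOn, fun d hd => ⟨G.next.symm d, ?_, by simp⟩⟩,
    fun d hd e he => ?_⟩
  · simpa [G.left_next] using hd
  · have := G.left_next (G.next.symm d)
    rw [Equiv.apply_symm_apply] at this
    simpa [← this] using hd
  · simp only [Finset.mem_coe, mem_cornersOf] at hd he
    exact (G.left_eq_iff d e).1 (hd.trans he.symm)

/-- The boundary walk of an internal face visits every vertex at most once, because closed faces
are embedded discs. -/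
theorem eq_of_left_eq_of_tail_eq {f : F} {d e : D} (hd : G.left d = Sum.inl f)
    (he : G.left e = Sum.inl f) (h : G.tail d = G.tail e) : d = e := by
  have hb : G.base f ∈ G.cornersOf (Sum.inl f) := by simpa using G.left_base f
  obtain ⟨i, hi, rfl⟩ := (G.isCycleOn_next (Sum.inl f)).exists_pow_eq hb (by simpa using hd)
  obtain ⟨j, hj, rfl⟩ := (G.isCycleOn_next (Sum.inl f)).exists_pow_eq hb (by simpa using he)
  have hc : Nat.card {d // G.left d = Sum.inl f} = (G.cornersOf (Sum.inl f)).card :=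
    (G.card_cornersOf _).symm
  set n := (G.cornersOf (Sum.inl f)).card with hn
  have key : ∀ m : ℕ, G.cell f (Complex.exp (2 * Real.pi * Complex.I * ((m : ℂ) / n))) =
      G.pos (G.tail ((G.next ^ m) (G.base f))) := by
    intro m
    have := G.cell_boundary f m 0
    rw [hc, G.curve_zero] at this
    simpa using this
  have hball : ∀ m : ℕ, Complex.exp (2 * Real.pi * Complex.I * ((m : ℂ) / n)) ∈
      Metric.closedBall (0 : ℂ) 1 := by
    intro m
    have : (2 * Real.pi * Complex.I * ((m : ℂ) / n)) =
        ((2 * Real.pi * (m / n) : ℝ) : ℂ) * Complex.I := by push_cast; ring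
    rw [this, mem_closedBall_zero_iff, Complex.norm_exp_ofReal_mul_I]
  have hexp := G.cell_injOn f (hball i) (hball j) (by rw [key, key, h])
  obtain ⟨m, hm⟩ := Complex.exp_eq_exp_iff_exists_int.1 hexp
  have hn0 : (n : ℂ) ≠ 0 := by
    have : n ≠ 0 := by omega
    exact_mod_cast this
  have hpi : (Real.pi : ℂ) ≠ 0 := by exact_mod_cast Real.pi_ne_zero
  have h1 : (i : ℂ) = j + m * n := by
    have hne : (2 * Real.pi * Complex.I : ℂ) ≠ 0 := by simp [hpi]
    have h2 : (2 * Real.pi * Complex.I : ℂ) * ((i : ℂ) / n) =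
        (2 * Real.pi * Complex.I) * ((j : ℂ) / n + m) := by rw [hm]; ring
    have h3 := mul_left_cancel₀ hne h2
    field_simp at h3
    rw [h3]
    ring
  have h2 : (i : ℤ) = j + m * n := by exact_mod_cast h1
  have h3 : i = j := by
    have hm0 : m = 0 := by
      by_contra hm0
      rcases lt_or_gt_of_ne hm0 with h | h
      · have : m * (n : ℤ) ≤ -1 * n := mul_le_mul_of_nonneg_right (by omega) (by positivity)
        omega
      · have : 1 * (n : ℤ) ≤ m * n := mul_le_mul_of_nonneg_right (by omega) (by positivity)
        omega
    rw [hm0] at h2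
    omega
  rw [h3]

/-- A function on directed edges that sums to zero around every internal face is the difference
of a potential on the vertices of that face. -/
theorem exists_face_potential (p : D → ZMod 2)
    (hp : ∀ f : F, ∑ d ∈ G.cornersOf (Sum.inl f), p d = 0) :
    ∃ φ : F → V → ZMod 2, ∀ f d, G.left d = Sum.inl f →
      φ f (G.tail (G.rev d)) = φ f (G.tail d) + p d := by
  have h := fun f => exists_potential_of_isCycleOn (G.isCycleOn_next (Sum.inl f))
    (b := G.base f) (by simpa using G.left_base f) p (hp f)
  choose ψ hψ using h
  let φ : F → V → ZMod 2 := fun f v =>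
    if h : ∃ d, G.left d = Sum.inl f ∧ G.tail d = v then ψ f h.choose else 0
  have hφ : ∀ f d, G.left d = Sum.inl f → φ f (G.tail d) = ψ f d := by
    intro f d hd
    have h : ∃ e, G.left e = Sum.inl f ∧ G.tail e = G.tail d := ⟨d, hd, rfl⟩
    have : h.choose = d := G.eq_of_left_eq_of_tail_eq h.choose_spec.1 hd h.choose_spec.2
    simp only [φ]
    rw [dif_pos h, this]
  refine ⟨φ, fun f d hd => ?_⟩
  rw [← G.tail_next, hφ _ _ ((G.left_next d).trans hd), hφ _ _ hd]
  exact hψ f d (by simpa using hd)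

/-! ### Incidence of vertices and faces modulo two -/

/-- The sum of `x` over the three corners at a vertex. For `x` the indicator of a set of faces this
is the support of the product of the face operators. -/
def vertexSum (x : F ⊕ Fin 2 → ZMod 2) (v : V) : ZMod 2 := ∑ d ∈ G.cornersAt v, x (G.left d)

/-- The sum of `B` around a face, i.e. the parity of the overlap of the face with `B`. -/
def faceSum (B : V → ZMod 2) (g : F ⊕ Fin 2) : ZMod 2 := ∑ d ∈ G.cornersOf g, B (G.tail d)

theorem sum_cornersAt [Fintype V] (h : D → ZMod 2) : ∑ v, ∑ d ∈ G.cornersAt v, h d = ∑ d, h d := by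
  simp only [cornersAt]
  exact Finset.sum_fiberwise _ _ _

theorem sum_cornersOf [Fintype F] (h : D → ZMod 2) : ∑ g, ∑ d ∈ G.cornersOf g, h d = ∑ d, h d := by
  simp only [cornersOf]
  exact Finset.sum_fiberwise _ _ _

theorem vertexSum_add (x y : F ⊕ Fin 2 → ZMod 2) (v : V) :
    G.vertexSum (x + y) v = G.vertexSum x v + G.vertexSum y v := by
  simp [vertexSum, Finset.sum_add_distrib]

section Trivalent

variable {G} (htri : ∀ u, Nat.card {d // G.tail d = u} = 3)
include htri

theorem card_cornersAt (v : V) : (G.cornersAt v).card = 3 := by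
  rw [← htri v, Nat.card_eq_fintype_card, Fintype.card_subtype, cornersAt]

theorem card_edges [Fintype V] : Fintype.card D = 3 * Fintype.card V := by
  rw [← Finset.card_univ, ← Finset.card_univ,
    Finset.card_eq_sum_card_fiberwise (f := G.tail) (t := Finset.univ) (by simp)]
  have : ∀ v ∈ (Finset.univ : Finset V), (Finset.univ.filter fun d => G.tail d = v).card = 3 :=
    fun v _ => card_cornersAt htri v
  rw [Finset.sum_congr rfl this, Finset.sum_const, smul_eq_mul, mul_comm]

theorem sum_corners_eq (d : D) (h : D → ZMod 2) :
    ∑ e ∈ G.cornersAt (G.tail d), h e = h d + h (G.rot d) + h (G.rot (G.rot d)) := by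
  rw [← sum_range_pow_of_isCycleOn (G.isCycleOn_rot (G.tail d)) (b := d) (by simp),
    card_cornersAt htri]
  simp [Finset.sum_range_succ, pow_succ]

theorem rot_rot_rot (d : D) : G.rot (G.rot (G.rot d)) = d := by
  have := (G.isCycleOn_rot (G.tail d)).pow_card_apply (a := d) (by simp)
  rw [card_cornersAt htri] at this
  simpa [pow_succ] using this

theorem eq_or_eq_rot {d e : D} (h : G.tail e = G.tail d) :
    e = d ∨ e = G.rot d ∨ e = G.rot (G.rot d) := by
  obtain ⟨n, hn, rfl⟩ := (G.isCycleOn_rot (G.tail d)).exists_pow_eq (a := d) (b := e) (by simp)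
    (by simpa using h)
  rw [card_cornersAt htri] at hn
  interval_cases n <;> simp [pow_succ]

theorem exists_tail_eq (v : V) : ∃ d, G.tail d = v := by
  have : (G.cornersAt v).Nonempty := by
    rw [← Finset.card_pos, card_cornersAt htri]; norm_num
  obtain ⟨d, hd⟩ := this
  exact ⟨d, by simpa using hd⟩

theorem rot_rot_next (d : D) : G.rot (G.rot (G.next d)) = G.rev d := by
  rw [← G.rot_rev, rot_rot_rot htri]

theorem vertexSum_tail (x : F ⊕ Fin 2 → ZMod 2) (d : D) : G.vertexSum x (G.tail d) =
    x (G.left d) + x (G.left (G.rev d)) + x (G.left (G.rot (G.rot d))) := by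
  rw [vertexSum, sum_corners_eq htri d, G.left_rot]

/-- Along the boundary of a face `g`, each neighbouring face enters the sums over the corners
twice, which leaves only the contributions of `g` itself. -/
theorem faceSum_vertexSum (x : F ⊕ Fin 2 → ZMod 2) (g : F ⊕ Fin 2) :
    G.faceSum (G.vertexSum x) g = G.boundaryCount g * x g := by
  have h3 : ∑ d ∈ G.cornersOf g, x (G.left (G.rot (G.rot d))) =
      ∑ d ∈ G.cornersOf g, x (G.left (G.rev d)) := by
    symm
    refine Finset.sum_nbij G.next ?_ G.next.injective.injOn (G.isCycleOn_next g).1.surjOn ?_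
    · intro d hd
      exact (G.isCycleOn_next g).1.mapsTo hd
    · intro d _
      rw [rot_rot_next htri]
  rw [faceSum, Finset.sum_congr rfl fun d _ => vertexSum_tail htri x d, Finset.sum_add_distrib,
    Finset.sum_add_distrib, h3, add_assoc, CharTwo.add_self_eq_zero, add_zero,
    Finset.sum_congr rfl (g := fun _ => x g), Finset.sum_const, card_cornersOf, nsmul_eq_mul]
  intro d hd
  rw [G.mem_cornersOf.1 hd]

end Trivalent

end Combinatorics

end CellDecomposition

namespace CellDecomposition

/-! ### Linear algebra of the incidence map -/

section LinearAlgebra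

open scoped Classical

variable {X : Type*} [TopologicalSpace X] {Φ : X ≃ₜ Cylinder} {V D F : Type*}
  [Fintype D] {G : CellDecomposition Φ V D F}

/-- Any two vertices are joined by edges: a nonempty set of vertices that is closed under passing
to neighbours is everything. -/
def IsConnected (G : CellDecomposition Φ V D F) : Prop :=
  ∀ Q : Set V, Q.Nonempty → (∀ d, G.tail d ∈ Q → G.tail (G.rev d) ∈ Q) → Q = Set.univ

theorem natCast_boundaryCount_inl [Fintype V] (hG : G.IsAdmissible) (f : F) :
    (G.boundaryCount (Sum.inl f) : ZMod 2) = 0 :=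
  (ZMod.natCast_eq_zero_iff_even).2 (hG.even_faces f)

theorem natCast_boundaryCount_inr [Fintype V] (hG : G.IsAdmissible) (i : Fin 2) :
    (G.boundaryCount (Sum.inr i) : ZMod 2) = 1 :=
  (ZMod.natCast_eq_one_iff_odd).2 (hG.odd_boundary i)

theorem faceSum_vertexSum_inl [Fintype V] (hG : G.IsAdmissible) (x : F ⊕ Fin 2 → ZMod 2) (f : F) :
    G.faceSum (G.vertexSum x) (Sum.inl f) = 0 := by
  rw [faceSum_vertexSum hG.trivalent, natCast_boundaryCount_inl hG, zero_mul]

theorem faceSum_vertexSum_inr [Fintype V] (hG : G.IsAdmissible) (x : F ⊕ Fin 2 → ZMod 2)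
    (i : Fin 2) : G.faceSum (G.vertexSum x) (Sum.inr i) = x (Sum.inr i) := by
  rw [faceSum_vertexSum hG.trivalent, natCast_boundaryCount_inr hG, one_mul]

theorem exists_left_eq [Fintype V] (hG : G.IsAdmissible) (g : F ⊕ Fin 2) :
    ∃ d, G.left d = g := by
  rcases g with f | i
  · exact ⟨_, G.left_base f⟩
  · have : (G.cornersOf (Sum.inr i)).Nonempty := by
      rw [← Finset.card_pos, card_cornersOf]
      exact (hG.odd_boundary i).pos
    obtain ⟨d, hd⟩ := this
    exact ⟨d, by simpa using hd⟩

/-- If the sums over the corners vanish everywhere, then the values at one vertex determine those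
at its neighbours, hence everywhere. -/
theorem eq_zero_of_vertexSum_eq_zero [Fintype V] (hG : G.IsAdmissible) (hc : G.IsConnected)
    {x : F ⊕ Fin 2 → ZMod 2} (hx : G.vertexSum x = 0) {d : D} (h0 : x (G.left d) = 0)
    (h1 : x (G.left (G.rot d)) = 0) : x = 0 := by
  have hsum : ∀ e, x (G.left e) + x (G.left (G.rev e)) + x (G.left (G.rot (G.rot e))) = 0 := by
    intro e
    rw [← vertexSum_tail hG.trivalent, hx, Pi.zero_apply]
  have hQ := hc {v | ∀ e, G.tail e = v → x (G.left e) = 0} ⟨G.tail d, ?_⟩ ?_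
  · funext g
    obtain ⟨e, rfl⟩ := exists_left_eq hG g
    have : G.tail e ∈ (Set.univ : Set V) := trivial
    rw [← hQ] at this
    exact this e rfl
  · intro e he
    have h2 := hsum d
    rw [← G.left_rot, h0, h1, zero_add, zero_add] at h2
    rcases eq_or_eq_rot hG.trivalent he with rfl | rfl | rfl
    exacts [h0, h1, h2]
  · intro e he e' he'
    have a0 : x (G.left (G.rev e)) = 0 := by
      rw [← G.left_rot]
      exact he _ (G.tail_rot e)
    have a1 : x (G.left (G.rot (G.rev e))) = 0 := by
      rw [G.rot_rev, G.left_next]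
      exact he _ rfl
    have a2 := hsum (G.rev e)
    rw [← G.left_rot (G.rev e), a0, a1, zero_add, zero_add] at a2
    rcases eq_or_eq_rot hG.trivalent he' with rfl | rfl | rfl
    exacts [a0, a1, a2]

variable (G) in
/-- The vertex-face incidence matrix modulo two. -/
def incidence : Matrix V (F ⊕ Fin 2) (ZMod 2) :=
  fun v g => ∑ d ∈ G.cornersAt v, if G.left d = g then 1 else 0

theorem incidence_mulVec [Fintype F] (x : F ⊕ Fin 2 → ZMod 2) :
    (G.incidence).mulVec x = G.vertexSum x := by
  funext v
  simp only [Matrix.mulVec, dotProduct, incidence, vertexSum, Finset.sum_mul]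
  rw [Finset.sum_comm]
  refine Finset.sum_congr rfl fun d _ => ?_
  simp

theorem incidence_transpose_mulVec [Fintype V] (B : V → ZMod 2) :
    (G.incidence).transpose.mulVec B = G.faceSum B := by
  funext g
  simp only [Matrix.mulVec, dotProduct, incidence, faceSum, Finset.sum_mul,
    Matrix.transpose_apply, cornersAt, cornersOf, Finset.sum_filter]
  rw [Finset.sum_comm]
  refine Finset.sum_congr rfl fun d _ => ?_
  simp

variable (G) in
/-- The incidence matrix of the vertices and the internal faces. -/
def innerIncidence : Matrix V F (ZMod 2) := (G.incidence).submatrix id Sum.inl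

theorem innerIncidence_transpose_mulVec [Fintype V] (B : V → ZMod 2) (f : F) :
    (G.innerIncidence).transpose.mulVec B f = G.faceSum B (Sum.inl f) := by
  rw [← incidence_transpose_mulVec]
  rfl

theorem innerIncidence_mulVec [Fintype F] (x : F → ZMod 2) :
    (G.innerIncidence).mulVec x = G.vertexSum (Sum.elim x 0) := by
  rw [← incidence_mulVec]
  funext v
  simp [innerIncidence, Matrix.mulVec, dotProduct]

theorem finrank_ker_incidence_le [Fintype V] [Fintype F] (hG : G.IsAdmissible)
    (hc : G.IsConnected) :
    Module.finrank (ZMod 2) (LinearMap.ker (G.incidence).mulVecLin) ≤ 1 := by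
  obtain ⟨d, hd⟩ := exists_left_eq hG (Sum.inr 0)
  let e : LinearMap.ker (G.incidence).mulVecLin →ₗ[ZMod 2] ZMod 2 :=
    LinearMap.proj (G.left (G.rot d)) ∘ₗ Submodule.subtype _
  have he : Function.Injective e := by
    rw [injective_iff_map_eq_zero]
    rintro ⟨x, hx⟩ hx1
    have hx' : G.vertexSum x = 0 := by
      rw [LinearMap.mem_ker, Matrix.mulVecLin_apply, incidence_mulVec] at hx
      exact hx
    have h0 : x (G.left d) = 0 := by
      rw [hd, ← faceSum_vertexSum_inr hG x 0, hx']
      simp [faceSum]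
    exact Subtype.ext (eq_zero_of_vertexSum_eq_zero hG hc hx' h0 hx1)
  simpa using LinearMap.finrank_le_finrank_of_injective he

theorem finrank_ker_innerIncidence_le [Fintype V] [Fintype F] (hG : G.IsAdmissible)
    (hc : G.IsConnected) :
    Module.finrank (ZMod 2) (LinearMap.ker (G.innerIncidence).mulVecLin) ≤ 1 := by
  obtain ⟨d, hd⟩ := exists_left_eq hG (Sum.inr 0)
  let e : LinearMap.ker (G.innerIncidence).mulVecLin →ₗ[ZMod 2] ZMod 2 :=
    { toFun := fun x => Sum.elim (x : F → ZMod 2) 0 (G.left (G.rot d))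
      map_add' := fun x y => by cases G.left (G.rot d) <;> simp
      map_smul' := fun x y => by cases G.left (G.rot d) <;> simp }
  have he : Function.Injective e := by
    rw [injective_iff_map_eq_zero]
    rintro ⟨x, hx⟩ hx1
    have hx' : G.vertexSum (Sum.elim x 0) = 0 := by
      rw [LinearMap.mem_ker, Matrix.mulVecLin_apply, innerIncidence_mulVec] at hx
      exact hx
    have h0 : Sum.elim x (0 : Fin 2 → ZMod 2) (G.left d) = 0 := by
      rw [hd]; rfl
    have := eq_zero_of_vertexSum_eq_zero hG hc hx' h0 hx1
    exact Subtype.ext (funext fun f => congrFun this (Sum.inl f))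
  simpa using LinearMap.finrank_le_finrank_of_injective he

theorem range_incidence_le [Fintype V] [Fintype F] (hG : G.IsAdmissible) :
    LinearMap.range (G.incidence).mulVecLin ≤
      LinearMap.ker (G.innerIncidence).transpose.mulVecLin := by
  rintro _ ⟨x, rfl⟩
  rw [LinearMap.mem_ker]
  funext f
  rw [Matrix.mulVecLin_apply, Matrix.mulVecLin_apply, incidence_mulVec,
    innerIncidence_transpose_mulVec, faceSum_vertexSum_inl hG, Pi.zero_apply]

theorem finrank_ker_transpose_add [Fintype V] [Fintype F] :
    Module.finrank (ZMod 2) (LinearMap.ker (G.innerIncidence).transpose.mulVecLin) +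
      Fintype.card F = Fintype.card V +
        Module.finrank (ZMod 2) (LinearMap.ker (G.innerIncidence).mulVecLin) := by
  have h1 := LinearMap.finrank_range_add_finrank_ker (G.innerIncidence).mulVecLin
  have h2 := LinearMap.finrank_range_add_finrank_ker (G.innerIncidence).transpose.mulVecLin
  have h3 := Matrix.rank_transpose (G.innerIncidence)
  rw [Matrix.rank, Matrix.rank] at h3
  rw [Module.finrank_fintype_fun_eq_card] at h1 h2
  omega

/-- Every set of vertices that overlaps evenly with all internal faces is a sum of internal and
external faces: by the Euler characteristic there is no room for anything else. -/
theorem exists_vertexSum_eq [Fintype V] [Fintype F] (hG : G.IsAdmissible) (hc : G.IsConnected)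
    (hE : Fintype.card V ≤ 2 * Fintype.card F) {B : V → ZMod 2}
    (hB : ∀ f, G.faceSum B (Sum.inl f) = 0) : ∃ x, G.vertexSum x = B := by
  have h1 := finrank_ker_incidence_le hG hc
  have h2 := finrank_ker_innerIncidence_le hG hc
  have h3 := finrank_ker_transpose_add (G := G)
  have h4 := LinearMap.finrank_range_add_finrank_ker (G.incidence).mulVecLin
  rw [Module.finrank_fintype_fun_eq_card, Fintype.card_sum, Fintype.card_fin] at h4
  have heq := Submodule.eq_of_le_of_finrank_le (range_incidence_le hG) (by omega)
  have hmem : B ∈ LinearMap.ker (G.innerIncidence).transpose.mulVecLin := by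
    rw [LinearMap.mem_ker]
    funext f
    rw [Matrix.mulVecLin_apply, innerIncidence_transpose_mulVec, hB f, Pi.zero_apply]
  rw [← heq] at hmem
  obtain ⟨x, hx⟩ := hmem
  exact ⟨x, by rw [← hx, Matrix.mulVecLin_apply, incidence_mulVec]⟩

/-- There is a set `z` of faces that contains two of the three faces at every vertex (the faces
that do not have the colour shared by both external faces). -/
theorem exists_two_faces_at_every_vertex [Fintype V] [Fintype F] (hG : G.IsAdmissible)
    (hc : G.IsConnected) (hE : Fintype.card V ≤ 2 * Fintype.card F) :
    ∃ z : F ⊕ Fin 2 → ZMod 2, G.vertexSum z = 0 ∧ (∀ i, z (Sum.inr i) = 0) ∧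
      ∀ d, ¬ (z (G.left d) = 0 ∧ z (G.left (G.rot d)) = 0) := by
  have h1 := finrank_ker_innerIncidence_le hG hc
  have h3 := finrank_ker_transpose_add (G := G)
  have h4 := LinearMap.finrank_range_add_finrank_ker (G.incidence).mulVecLin
  rw [Module.finrank_fintype_fun_eq_card, Fintype.card_sum, Fintype.card_fin] at h4
  have h5 := Submodule.finrank_mono (range_incidence_le hG)
  have hpos : 0 < Module.finrank (ZMod 2) (LinearMap.ker (G.incidence).mulVecLin) := by omega
  rw [Module.finrank_pos_iff_exists_ne_zero] at hpos
  obtain ⟨⟨z, hz⟩, hz0⟩ := hpos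
  rw [LinearMap.mem_ker, Matrix.mulVecLin_apply, incidence_mulVec] at hz
  refine ⟨z, hz, fun i => ?_, fun d hd => hz0 (Subtype.ext ?_)⟩
  · rw [← faceSum_vertexSum_inr hG z i, hz]
    simp [faceSum]
  · exact eq_zero_of_vertexSum_eq_zero hG hc hz hd.1 hd.2

theorem sum_vertexSum [Fintype V] [Fintype F] (hG : G.IsAdmissible) (x : F ⊕ Fin 2 → ZMod 2) :
    ∑ v, G.vertexSum x v = x (Sum.inr 0) + x (Sum.inr 1) := by
  have h : ∀ g, ∑ d ∈ G.cornersOf g, x (G.left d) = G.boundaryCount g * x g := by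
    intro g
    rw [← card_cornersOf, ← nsmul_eq_mul, ← Finset.sum_const]
    exact Finset.sum_congr rfl fun d hd => by rw [G.mem_cornersOf.1 hd]
  simp only [vertexSum]
  rw [G.sum_cornersAt, ← G.sum_cornersOf]
  simp [h, natCast_boundaryCount_inl hG, natCast_boundaryCount_inr hG]

end LinearAlgebra

end CellDecomposition

namespace CellDecomposition

/-! ### Walks, clusters, and parity -/

section Walks

open scoped Classical

variable {X : Type*} [TopologicalSpace X] {Φ : X ≃ₜ Cylinder} {V D F : Type*}
  [Fintype D] {G : CellDecomposition Φ V D F}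

/-- `G.EdgeWalk u v n`: there is a walk of `n` edges from `u` to `v`. -/
inductive EdgeWalk (G : CellDecomposition Φ V D F) : V → V → ℕ → Prop
  | nil (v : V) : EdgeWalk G v v 0
  | cons (d : D) {v : V} {n : ℕ} (h : EdgeWalk G (G.tail (G.rev d)) v n) :
    EdgeWalk G (G.tail d) v (n + 1)

theorem EdgeWalk.single (d : D) : G.EdgeWalk (G.tail d) (G.tail (G.rev d)) 1 :=
  .cons d (.nil _)

theorem EdgeWalk.trans {u v w : V} {m n : ℕ} (h : G.EdgeWalk u v m) (h' : G.EdgeWalk v w n) :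
    G.EdgeWalk u w (m + n) := by
  induction h with
  | nil => rwa [zero_add]
  | cons d _ ih => rw [add_right_comm]; exact .cons d (ih h')

theorem EdgeWalk.symm {u v : V} {n : ℕ} (h : G.EdgeWalk u v n) : G.EdgeWalk v u n := by
  induction h with
  | nil => exact .nil _
  | cons d _ ih =>
    refine ih.trans ?_
    have := EdgeWalk.single (G := G) (G.rev d)
    rwa [G.rev_rev] at this

theorem edgeWalk_next_pow (d : D) (n : ℕ) :
    G.EdgeWalk (G.tail d) (G.tail ((G.next ^ n) d)) n := by
  induction n with
  | zero => exact .nil _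
  | succ n ih =>
    rw [pow_succ', Equiv.Perm.mul_apply, tail_next]
    exact ih.trans (.single _)

theorem exists_next_pow_eq {f : F} {d e : D} (hd : G.left d = Sum.inl f)
    (he : G.left e = Sum.inl f) {k : ℕ} (hk : ∀ f : F, G.boundaryCount (Sum.inl f) ≤ k) :
    ∃ n ≤ k, (G.next ^ n) d = e := by
  obtain ⟨n, hn, h⟩ := (G.isCycleOn_next (Sum.inl f)).exists_pow_eq (a := d) (b := e)
    (by simpa using hd) (by simpa using he)
  rw [card_cornersOf] at hn
  exact ⟨n, hn.le.trans (hk f), h⟩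

variable (G) in
/-- The graph on a set `A` of vertices that joins two vertices of a common internal face. Its
connected components are the clusters of `A`. -/
def clusterGraph (A : Finset V) : SimpleGraph A where
  Adj u v := u ≠ v ∧ ∃ f d e, G.left d = Sum.inl f ∧ G.left e = Sum.inl f ∧
    G.tail d = u ∧ G.tail e = v
  symm := ⟨fun _ _ ⟨hne, f, d, e, hd, he, hu, hv⟩ => ⟨hne.symm, f, e, d, he, hd, hv, hu⟩⟩
  loopless := ⟨fun _ h => h.1 rfl⟩

theorem reachable_clusterGraph {A : Finset V} {f : F} {d e : D} (hd : G.left d = Sum.inl f)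
    (he : G.left e = Sum.inl f) (hdA : G.tail d ∈ A) (heA : G.tail e ∈ A) :
    (G.clusterGraph A).Reachable ⟨_, hdA⟩ ⟨_, heA⟩ := by
  by_cases h : (⟨_, hdA⟩ : A) = ⟨_, heA⟩
  · rw [h]
  · exact SimpleGraph.Adj.reachable ⟨h, f, d, e, hd, he, rfl, rfl⟩

theorem exists_edgeWalk_of_reachable {A : Finset V} {k : ℕ}
    (hk : ∀ f : F, G.boundaryCount (Sum.inl f) ≤ k) {u v : A}
    (h : (G.clusterGraph A).Reachable u v) : ∃ n ≤ A.card * k, G.EdgeWalk (u : V) v n := by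
  have key : ∀ {u v : A} (w : (G.clusterGraph A).Walk u v),
      ∃ n ≤ w.length * k, G.EdgeWalk (u : V) v n := by
    intro u v w
    induction w with
    | nil => exact ⟨0, by simp, .nil _⟩
    | cons hadj w ih =>
      have hadj' := hadj
      obtain ⟨-, f, d, e, hd, he, hu, hv⟩ := hadj'
      obtain ⟨n, hn, hw⟩ := ih
      obtain ⟨m, hm, rfl⟩ := exists_next_pow_eq hd he hk
      refine ⟨m + n, ?_, ?_⟩
      · rw [SimpleGraph.Walk.length_cons, add_mul, one_mul]
        omega
      · rw [← hu]
        refine (edgeWalk_next_pow d m).trans ?_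
        rwa [hv]
  obtain ⟨p, hp⟩ := h.exists_isPath
  obtain ⟨n, hn, hw⟩ := key p
  refine ⟨n, hn.trans (Nat.mul_le_mul_right k ?_), hw⟩
  have := hp.length_lt
  rw [Fintype.card_coe] at this
  exact this.le

/-- The indicator vector of a set of vertices modulo two. -/
def supportVec (A : Finset V) (v : V) : ZMod 2 := if v ∈ A then 1 else 0

theorem sum_supportVec [Fintype V] (A : Finset V) : ∑ v, supportVec A v = A.card := by
  simp [supportVec]

/-- At a vertex of a face of `z`, the value of `z` on the face before it in the rotation tells which
of the two faces of `z` it is; along the boundary of the face this alternates. -/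
theorem rot_rot_next_pow {z : F ⊕ Fin 2 → ZMod 2}
    (htri : ∀ u, Nat.card {d // G.tail d = u} = 3) (hz : G.vertexSum z = 0) {d : D}
    (hd : z (G.left d) = 1) (n : ℕ) : z (G.left (G.rot (G.rot ((G.next ^ n) d)))) =
      z (G.left (G.rot (G.rot d))) + n := by
  induction n with
  | zero => simp
  | succ n ih =>
    have hl : G.left ((G.next ^ n) d) = G.left d := by
      rw [← G.mem_cornersOf]
      exact (G.isCycleOn_next (G.left d)).1.mapsTo.perm_pow n (by simp)
    have h := vertexSum_tail htri z ((G.next ^ n) d)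
    rw [hz, Pi.zero_apply, hl, hd, ih] at h
    rw [pow_succ', Equiv.Perm.mul_apply, rot_rot_next htri, Nat.cast_succ]
    generalize z (G.left (G.rev ((G.next ^ n) d))) = a, (n : ZMod 2) = b,
      z (G.left (G.rot (G.rot d))) = c at h ⊢
    revert a b c
    decide

/-- For three faces at a vertex with values `a`, `b`, `c` of `z`, exactly two of which are one, the
labels `s + c`, `s + a`, `s + b` of these two faces add up to one. -/
theorem two_faces_identity : ∀ a b c s : ZMod 2, a + b + c = 0 → ¬ (a = 0 ∧ b = 0) →
    a * (s + c) + b * (s + a) + c * (s + b) = 1 := by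
  decide

/-- If `A` overlaps evenly with all faces and all short closed walks are even, then `A` is even.
The parity of walks from a root in each cluster tells which of the two faces of `z` at a vertex of
`A` to choose, consistently for the vertices of one face; hence `A` is partitioned by its overlaps
with the chosen faces. -/
theorem even_card_of_short_closed_walks_even [Fintype V] [Fintype F] (hG : G.IsAdmissible)
    (hc : G.IsConnected) (hE : Fintype.card V ≤ 2 * Fintype.card F) {A : Finset V}
    (hA : ∀ f, G.faceSum (supportVec A) (Sum.inl f) = 0) {k : ℕ}
    (hk : ∀ f : F, G.boundaryCount (Sum.inl f) ≤ k)
    (hwalk : ∀ v n, G.EdgeWalk v v n → n ≤ 3 * A.card * k → Even n) : Even A.card := by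
  obtain ⟨z, hz, hz2, hz3⟩ := exists_two_faces_at_every_vertex hG hc hE
  let root : A → A := fun v => ((G.clusterGraph A).connectedComponentMk v).out
  have hroot : ∀ v, (G.clusterGraph A).Reachable (root v) v := fun v =>
    SimpleGraph.ConnectedComponent.exact (Quot.out_eq _)
  choose n hn hnw using fun v => exists_edgeWalk_of_reachable hk (hroot v)
  -- The parity `n v` of a walk from the root changes by `m` over `m` steps along a face, since
  -- otherwise there is a short odd closed walk through the root.
  have hstep : ∀ (d : D) (m : ℕ), m ≤ k → ∀ (f : F), G.left d = Sum.inl f → ∀ (hd : G.tail d ∈ A)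
      (he : G.tail ((G.next ^ m) d) ∈ A),
      (n ⟨_, he⟩ : ZMod 2) = n ⟨_, hd⟩ + m := by
    intro d m hm f hf hd he
    have hl : G.left ((G.next ^ m) d) = Sum.inl f := by
      rw [← G.mem_cornersOf]
      exact (G.isCycleOn_next (Sum.inl f)).1.mapsTo.perm_pow m (by simpa using hf)
    have hr : root ⟨_, he⟩ = root ⟨_, hd⟩ := by
      simp only [root]
      rw [SimpleGraph.ConnectedComponent.sound (reachable_clusterGraph hl hf he hd)]
    have h1 := hnw ⟨_, he⟩
    rw [hr] at h1
    have h2 := ((hnw ⟨_, hd⟩).trans (edgeWalk_next_pow d m)).trans h1.symm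
    have hpos : 0 < A.card := Finset.card_pos.2 ⟨_, hd⟩
    have hle : n ⟨_, hd⟩ + m + n ⟨_, he⟩ ≤ 3 * A.card * k := by
      have a1 := hn ⟨_, hd⟩
      have a2 := hn ⟨_, he⟩
      have a3 : k ≤ A.card * k := Nat.le_mul_of_pos_left k hpos
      have a4 : 3 * A.card * k = 3 * (A.card * k) := by ring
      omega
    have h3 := (ZMod.natCast_eq_zero_iff_even).2 (hwalk _ _ h2 hle)
    push_cast at h3
    rw [← CharTwo.add_eq_zero, add_comm]
    exact h3
  let s : V → ZMod 2 := fun v => if h : v ∈ A then n ⟨v, h⟩ else 0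
  -- The faces of `z` at the vertices of `A` with label `κ = 1` are the selected ones.
  let κ : D → ZMod 2 := fun d => s (G.tail d) + z (G.left (G.rot (G.rot d)))
  have hs : ∀ v (h : v ∈ A), s v = n ⟨v, h⟩ := fun v h => dif_pos h
  have hκ : ∀ d e f, G.left d = Sum.inl f → G.left e = Sum.inl f → z (Sum.inl f) = 1 →
      G.tail d ∈ A → G.tail e ∈ A → κ e = κ d := by
    intro d e f hd he hf hdA heA
    obtain ⟨m, hm, rfl⟩ := exists_next_pow_eq hd he hk
    simp only [κ]
    rw [hs _ hdA, hs _ heA, hstep d m hm f hd hdA heA,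
      rot_rot_next_pow hG.trivalent hz (by rw [hd, hf]) m]
    generalize (m : ZMod 2) = a, (n ⟨_, hdA⟩ : ZMod 2) = b, z (G.left (G.rot (G.rot d))) = c
    revert a b c
    decide
  have h1 : ∀ v, ∑ d ∈ G.cornersAt v, z (G.left d) * κ d = 1 := by
    intro v
    obtain ⟨d, rfl⟩ := exists_tail_eq hG.trivalent v
    have h0 := sum_corners_eq hG.trivalent d fun e => z (G.left e)
    rw [show ∑ e ∈ G.cornersAt (G.tail d), z (G.left e) = 0 from congrFun hz _] at h0
    rw [sum_corners_eq hG.trivalent d]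
    simp only [κ, G.tail_rot, rot_rot_rot hG.trivalent]
    exact two_faces_identity _ _ _ _ h0.symm (hz3 d)
  have h2 : ∀ g, ∑ d ∈ G.cornersOf g, supportVec A (G.tail d) * (z (G.left d) * κ d) = 0 := by
    intro g
    have hcongr : ∀ c, (∀ d ∈ G.cornersOf g, G.tail d ∈ A → z (G.left d) * κ d = c) →
        ∑ d ∈ G.cornersOf g, supportVec A (G.tail d) * (z (G.left d) * κ d) =
          G.faceSum (supportVec A) g * c := by
      intro c hcd
      rw [faceSum, Finset.sum_mul]
      refine Finset.sum_congr rfl fun d hd => ?_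
      by_cases hdA : G.tail d ∈ A
      · rw [hcd d hd hdA]
      · simp [supportVec, hdA]
    by_cases hzg : z g = 0
    · rw [hcongr 0, mul_zero]
      intro d hd _
      rw [G.mem_cornersOf.1 hd, hzg, zero_mul]
    · rcases g with f | i
      · have hzf : z (Sum.inl f) = 1 := by
          generalize z (Sum.inl f) = a at hzg
          revert a
          decide
        by_cases hex : ∃ d₀ ∈ G.cornersOf (Sum.inl f), G.tail d₀ ∈ A
        · obtain ⟨d₀, hd₀, hd₀A⟩ := hex
          rw [hcongr (κ d₀), hA, zero_mul]
          intro d hd hdA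
          rw [mem_cornersOf] at hd hd₀
          rw [hκ d₀ d f hd₀ hd hzf hd₀A hdA, hd, hzf, one_mul]
        · rw [hcongr 0, mul_zero]
          intro d hd hdA
          exact absurd ⟨d, hd, hdA⟩ hex
      · exact absurd (hz2 i) hzg
  have h3 : ∑ v, supportVec A v = 0 := by
    calc ∑ v, supportVec A v
        = ∑ v, ∑ d ∈ G.cornersAt v, supportVec A (G.tail d) * (z (G.left d) * κ d) := by
          refine Finset.sum_congr rfl fun v _ => ?_
          rw [← mul_one (supportVec A v), ← h1 v, Finset.mul_sum]
          exact Finset.sum_congr rfl fun d hd => by rw [(G.mem_cornersAt).1 hd]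
      _ = 0 := by
          rw [G.sum_cornersAt, ← G.sum_cornersOf]
          exact Finset.sum_eq_zero fun g _ => h2 g
  rw [sum_supportVec] at h3
  exact (ZMod.natCast_eq_zero_iff_even).1 h3

end Walks

end CellDecomposition

namespace CellDecomposition

/-! ### Open stars of vertices -/

section Stars

variable {X : Type*} [TopologicalSpace X] {Φ : X ≃ₜ Cylinder} {V D F : Type*}
  [Fintype D] (G : CellDecomposition Φ V D F)

/-- The closed face `f`. -/
def closedFace (f : F) : Set X := G.cell f '' Metric.closedBall 0 1

/-- The open star of a vertex: the points such that every closed cell (vertex, edge or face) that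
contains the point also contains the vertex. -/
def star (v : V) : Set X :=
  {x | (∀ w, x = G.pos w → w = v) ∧
    (∀ d, x ∈ Set.range (G.curve d) → G.tail d = v ∨ G.tail (G.rev d) = v) ∧
    ∀ f, x ∈ G.closedFace f → ∃ d, G.left d = Sum.inl f ∧ G.tail d = v}

theorem isClosed_closedFace [T2Space X] (f : F) : IsClosed (G.closedFace f) :=
  ((isCompact_closedBall (0 : ℂ) 1).image_of_continuousOn (G.cell_continuousOn f)).isClosed

theorem isOpen_star [T2Space X] [Finite V] [Finite F] (v : V) : IsOpen (G.star v) := by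
  have h1 : IsClosed (⋃ w ∈ {w | w ≠ v}, {G.pos w}) :=
    (Set.toFinite _).isClosed_biUnion fun w _ => isClosed_singleton
  have h2 : IsClosed (⋃ d ∈ {d | ¬ (G.tail d = v ∨ G.tail (G.rev d) = v)},
      Set.range (G.curve d)) :=
    (Set.toFinite _).isClosed_biUnion fun d _ => (isCompact_range (G.curve d).continuous).isClosed
  have h3 : IsClosed (⋃ f ∈ {f | ¬ ∃ d, G.left d = Sum.inl f ∧ G.tail d = v}, G.closedFace f) :=
    (Set.toFinite _).isClosed_biUnion fun f _ => G.isClosed_closedFace f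
  convert ((h1.union h2).union h3).isOpen_compl using 1
  ext x
  simp only [star, Set.mem_ofPred_eq, Set.mem_compl_iff, Set.mem_union, Set.mem_iUnion,
    Set.mem_singleton_iff, exists_prop, not_or, not_exists, not_and]
  refine ⟨fun ⟨a, b, c⟩ => ⟨⟨fun w hw e => hw (a w e), fun d hd e => ?_⟩, fun f hf e => ?_⟩,
    fun ⟨⟨a, b⟩, c⟩ => ⟨fun w e => ?_, fun d e => ?_, fun f e => ?_⟩⟩
  · rcases b d e with h | h
    exacts [hd.1 h, hd.2 h]
  · obtain ⟨d, hd, h⟩ := c f e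
    exact hf d hd h
  · by_contra h
    exact a w h e
  · by_contra h
    exact b d (not_or.1 h) e
  · by_contra h
    exact c f (fun d hd hv => h ⟨d, hd, hv⟩) e

theorem unitInterval_cases (t : unitInterval) :
    t = 0 ∨ t = 1 ∨ t ∈ Set.Ioo (0 : unitInterval) 1 := by
  rcases eq_or_lt_of_le (unitInterval.nonneg' : 0 ≤ t) with h | h
  · exact Or.inl h.symm
  · rcases eq_or_lt_of_le (unitInterval.le_one' : t ≤ 1) with h' | h'
    · exact Or.inr (Or.inl h')
    · exact Or.inr (Or.inr ⟨h, h'⟩)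

variable {G}

theorem tail_eq_of_pos_mem_range {v : V} {d : D} (h : G.pos v ∈ Set.range (G.curve d)) :
    G.tail d = v ∨ G.tail (G.rev d) = v := by
  obtain ⟨t, ht⟩ := h
  rcases unitInterval_cases t with rfl | rfl | h
  · rw [G.curve_zero] at ht
    exact Or.inl (G.pos_injective ht)
  · rw [G.curve_one] at ht
    exact Or.inr (G.pos_injective ht)
  · exact absurd ht (G.curve_ne_pos d t h v)

theorem eq_or_eq_rev_of_curve_mem_range {d e : D} {t : unitInterval}
    (ht : t ∈ Set.Ioo (0 : unitInterval) 1) (h : G.curve d t ∈ Set.range (G.curve e)) :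
    e = d ∨ e = G.rev d := by
  obtain ⟨s, hs⟩ := h
  rcases unitInterval_cases s with rfl | rfl | h
  · rw [G.curve_zero] at hs
    exact absurd hs.symm (G.curve_ne_pos d t ht _)
  · rw [G.curve_one] at hs
    exact absurd hs.symm (G.curve_ne_pos d t ht _)
  · rcases G.curve_injective d e t ht s h hs.symm with h | h
    exacts [Or.inl h.1, Or.inr h.1]

/-- Every point of the unit circle lies on one of `n` equal arcs. -/
theorem exists_exp_eq_of_norm_eq_one {z : ℂ} (hz : ‖z‖ = 1) {n : ℕ} (hn : 0 < n) :
    ∃ (j : ℕ) (t : unitInterval),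
      Complex.exp (2 * Real.pi * Complex.I * ((j + ((t : ℝ) : ℂ)) / (n : ℂ))) = z := by
  set θ : ℝ := Int.fract (Complex.arg z / (2 * Real.pi)) with hθ
  have h0 : 0 ≤ θ * n := mul_nonneg (Int.fract_nonneg _) (Nat.cast_nonneg _)
  refine ⟨⌊θ * n⌋₊, ⟨Int.fract (θ * n), Int.fract_nonneg _, (Int.fract_lt_one _).le⟩, ?_⟩
  have h1 : ((⌊θ * n⌋₊ : ℕ) : ℝ) + Int.fract (θ * n) = θ * n := by
    rw [natCast_floor_eq_intCast_floor h0]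
    exact Int.floor_add_fract _
  have h2 : ((⌊θ * n⌋₊ : ℕ) : ℂ) + ((Int.fract (θ * n) : ℝ) : ℂ) = (θ : ℂ) * n := by
    exact_mod_cast congrArg (fun r : ℝ => (r : ℂ)) h1
  have hn' : (n : ℂ) ≠ 0 := by exact_mod_cast hn.ne'
  have hpi : (Real.pi : ℂ) ≠ 0 := by exact_mod_cast Real.pi_ne_zero
  change Complex.exp (2 * Real.pi * Complex.I *
    ((((⌊θ * n⌋₊ : ℕ) : ℂ) + ((Int.fract (θ * n) : ℝ) : ℂ)) / n)) = z
  rw [h2, mul_div_cancel_right₀ _ hn']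
  have h3 : (θ : ℂ) = Complex.arg z / (2 * Real.pi) -
      (⌊Complex.arg z / (2 * Real.pi)⌋ : ℤ) := by
    rw [hθ, Int.fract]
    push_cast
    ring
  rw [h3]
  have h4 : 2 * Real.pi * Complex.I * ((Complex.arg z : ℂ) / (2 * Real.pi) -
      (⌊Complex.arg z / (2 * Real.pi)⌋ : ℤ)) =
      Complex.arg z * Complex.I -
        (⌊Complex.arg z / (2 * Real.pi)⌋ : ℤ) * (2 * Real.pi * Complex.I) := by
    field_simp
  rw [h4, Complex.exp_sub, Complex.exp_int_mul_two_pi_mul_I, div_one]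
  have := Complex.norm_mul_exp_arg_mul_I z
  rwa [hz, Complex.ofReal_one, one_mul] at this

/-- A point of a closed face lies in the open face or on an edge of its boundary. -/
theorem mem_closedFace_cases {x : X} {f : F} (h : x ∈ G.closedFace f) :
    (∃ z ∈ Metric.ball (0 : ℂ) 1, G.cell f z = x) ∨
      ∃ e t, G.left e = Sum.inl f ∧ G.curve e t = x := by
  obtain ⟨z, hz, rfl⟩ := h
  rw [mem_closedBall_zero_iff] at hz
  rcases lt_or_eq_of_le hz with h | h
  · exact Or.inl ⟨z, by simpa using h, rfl⟩
  · have hpos : 0 < Nat.card {d // G.left d = Sum.inl f} :=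
      have : Nonempty {d // G.left d = Sum.inl f} := ⟨⟨_, G.left_base f⟩⟩
      Nat.card_pos
    obtain ⟨j, t, rfl⟩ := exists_exp_eq_of_norm_eq_one h hpos
    refine Or.inr ⟨(G.next ^ j) (G.base f), t, ?_, (G.cell_boundary f j t).symm⟩
    rw [(G.left_eq_iff _ (G.base f)).2 (Equiv.Perm.sameCycle_pow_left.2 (.refl _ _)), G.left_base]

theorem exists_corner_of_pos_mem_closedFace (hex : ∀ v, ∃ d, G.tail d = v) {v : V} {f : F}
    (h : G.pos v ∈ G.closedFace f) : ∃ d, G.left d = Sum.inl f ∧ G.tail d = v := by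
  rcases mem_closedFace_cases h with ⟨z, hz, h⟩ | ⟨e, t, he, h⟩
  · obtain ⟨d, rfl⟩ := hex v
    rw [← G.curve_zero] at h
    exact absurd h (G.cell_ne_curve f z hz d 0)
  · rcases tail_eq_of_pos_mem_range ⟨t, h⟩ with h | h
    · exact ⟨e, he, h⟩
    · exact ⟨G.next e, (G.left_next e).trans he, (G.tail_next e).trans h⟩

theorem left_eq_of_curve_mem_closedFace {d : D} {f : F} {t : unitInterval}
    (ht : t ∈ Set.Ioo (0 : unitInterval) 1) (h : G.curve d t ∈ G.closedFace f) :
    G.left d = Sum.inl f ∨ G.left (G.rev d) = Sum.inl f := by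
  rcases mem_closedFace_cases h with ⟨z, hz, h⟩ | ⟨e, s, he, h⟩
  · exact absurd h (G.cell_ne_curve f z hz d t)
  · rcases eq_or_eq_rev_of_curve_mem_range ht ⟨s, h⟩ with rfl | rfl
    exacts [Or.inl he, Or.inr he]

theorem exists_corner_of_curve_mem_closedFace {d : D} {f : F} {t : unitInterval}
    (ht : t ∈ Set.Ioo (0 : unitInterval) 1) (h : G.curve d t ∈ G.closedFace f) :
    ∃ e, G.left e = Sum.inl f ∧ G.tail e = G.tail d := by
  rcases left_eq_of_curve_mem_closedFace ht h with h | h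
  · exact ⟨d, h, rfl⟩
  · refine ⟨G.next (G.rev d), (G.left_next _).trans h, ?_⟩
    rw [G.tail_next, G.rev_rev]

theorem pos_mem_star (hex : ∀ v, ∃ d, G.tail d = v) (v : V) : G.pos v ∈ G.star v :=
  ⟨fun _ h => (G.pos_injective h).symm, fun _ h => tail_eq_of_pos_mem_range h,
    fun _ h => exists_corner_of_pos_mem_closedFace hex h⟩

theorem curve_mem_star_tail {d : D} {t : unitInterval} (ht : t ∈ Set.Ioo (0 : unitInterval) 1) :
    G.curve d t ∈ G.star (G.tail d) := by
  refine ⟨fun w h => absurd h (G.curve_ne_pos d t ht w), fun e h => ?_,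
    fun f h => exists_corner_of_curve_mem_closedFace ht h⟩
  rcases eq_or_eq_rev_of_curve_mem_range ht h with rfl | rfl
  · exact Or.inl rfl
  · exact Or.inr (by rw [G.rev_rev])

theorem symm_mem_Ioo {t : unitInterval} (ht : t ∈ Set.Ioo (0 : unitInterval) 1) :
    unitInterval.symm t ∈ Set.Ioo (0 : unitInterval) 1 := by
  have h0 : (0 : ℝ) < t := ht.1
  have h1 : (t : ℝ) < 1 := ht.2
  refine ⟨Subtype.coe_lt_coe.1 ?_, Subtype.coe_lt_coe.1 ?_⟩ <;> simp <;> assumption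

theorem curve_mem_star_head {d : D} {t : unitInterval} (ht : t ∈ Set.Ioo (0 : unitInterval) 1) :
    G.curve d t ∈ G.star (G.tail (G.rev d)) := by
  have h := G.curve_rev (G.rev d) t
  rw [G.rev_rev] at h
  rw [h]
  exact curve_mem_star_tail (symm_mem_Ioo ht)

/-- Every point is a vertex, an interior point of an edge, or a point of an open face. -/
theorem point_cases (x : X) : (∃ v, x = G.pos v) ∨
    (∃ d, ∃ t ∈ Set.Ioo (0 : unitInterval) 1, x = G.curve d t) ∨
    ∃ f, ∃ z ∈ Metric.ball (0 : ℂ) 1, G.cell f z = x := by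
  obtain ⟨f, z, hz, h⟩ := G.cell_cover x
  rcases mem_closedFace_cases ⟨z, hz, h⟩ with h | ⟨e, t, _, rfl⟩
  · exact Or.inr (Or.inr ⟨f, h⟩)
  · rcases unitInterval_cases t with rfl | rfl | ht
    · exact Or.inl ⟨_, G.curve_zero e⟩
    · exact Or.inl ⟨_, G.curve_one e⟩
    · exact Or.inr (Or.inl ⟨e, t, ht, rfl⟩)

theorem eq_of_cell_mem_closedFace {f g : F} {z : ℂ} (hz : z ∈ Metric.ball (0 : ℂ) 1)
    (h : G.cell f z ∈ G.closedFace g) : f = g := by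
  rcases mem_closedFace_cases h with ⟨w, hw, h⟩ | ⟨e, t, _, h⟩
  · exact G.cell_disjoint f g z hz w hw h.symm
  · exact absurd h.symm (G.cell_ne_curve f z hz e t)

theorem exists_mem_star (hex : ∀ v, ∃ d, G.tail d = v) (x : X) : ∃ v, x ∈ G.star v := by
  rcases point_cases (G := G) x with ⟨v, rfl⟩ | ⟨d, t, ht, rfl⟩ | ⟨f, z, hz, rfl⟩
  · exact ⟨v, pos_mem_star hex v⟩
  · exact ⟨_, curve_mem_star_tail ht⟩
  · refine ⟨G.tail (G.base f), fun w h => ?_, fun d h => ?_, fun g h => ?_⟩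
    · obtain ⟨d, rfl⟩ := hex w
      rw [← G.curve_zero] at h
      exact absurd h (G.cell_ne_curve f z hz d 0)
    · obtain ⟨t, ht⟩ := h
      exact absurd ht.symm (G.cell_ne_curve f z hz d t)
    · rw [← eq_of_cell_mem_closedFace hz h]
      exact ⟨_, G.left_base f, rfl⟩

theorem exists_mem_closedFace (x : X) : ∃ f, x ∈ G.closedFace f := by
  obtain ⟨f, z, hz, h⟩ := G.cell_cover x
  exact ⟨f, z, hz, h⟩

/-- The graph is connected because the cylinder is: the open stars of a union of components of the
graph and of its complement would disconnect the cylinder. -/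
theorem isConnected_of_corners [T2Space X] [Finite V] [Finite F] (hex : ∀ v, ∃ d, G.tail d = v) :
    G.IsConnected := by
  intro Q hQ hadj
  have hX : PreconnectedSpace X := by
    have := Φ.symm.surjective.denseRange.preconnectedSpace Φ.symm.continuous
    exact this
  have key : ∀ u v x, x ∈ G.star u → x ∈ G.star v → u ∈ Q → v ∈ Q := by
    intro u v x hu hv huQ
    obtain ⟨f, hf⟩ := exists_mem_closedFace (G := G) x
    obtain ⟨d, hd, rfl⟩ := hu.2.2 f hf
    obtain ⟨e, he, rfl⟩ := hv.2.2 f hf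
    obtain ⟨n, -, rfl⟩ := (G.isCycleOn_next (Sum.inl f)).exists_pow_eq (a := d) (b := e)
      (by simpa using hd) (by simpa using he)
    clear he hv
    induction n with
    | zero => exact huQ
    | succ n ih =>
      rw [pow_succ', Equiv.Perm.mul_apply, tail_next]
      exact hadj _ ih
  by_contra hne
  obtain ⟨u, hu⟩ := hQ
  obtain ⟨v, hv⟩ := (Set.ne_univ_iff_exists_notMem Q).1 hne
  obtain ⟨x, -, hx1, hx2⟩ := hX.isPreconnected_univ (⋃ w ∈ Q, G.star w) (⋃ w ∈ Qᶜ, G.star w)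
    (isOpen_biUnion fun w _ => G.isOpen_star w) (isOpen_biUnion fun w _ => G.isOpen_star w)
    (fun x _ => by
      obtain ⟨w, hw⟩ := exists_mem_star hex x
      by_cases h : w ∈ Q
      · exact Or.inl (Set.mem_biUnion h hw)
      · exact Or.inr (Set.mem_biUnion h hw))
    ⟨G.pos u, trivial, Set.mem_biUnion hu (pos_mem_star hex u)⟩
    ⟨G.pos v, trivial, Set.mem_biUnion (show v ∈ Qᶜ from hv) (pos_mem_star hex v)⟩
  simp only [Set.mem_iUnion, exists_prop] at hx1 hx2
  obtain ⟨w, hw, hxw⟩ := hx1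
  obtain ⟨w', hw', hxw'⟩ := hx2
  exact hw' (key _ _ _ hxw hxw' hw)

end Stars

end CellDecomposition

namespace CellDecomposition

/-! ### The double cover of a cocycle -/

section Sheets

variable {X : Type*} [TopologicalSpace X] {Φ : X ≃ₜ Cylinder} {V D F : Type*}
  [Fintype D] (G : CellDecomposition Φ V D F)

/-- `φ` is a family of potentials, one on the vertices of each internal face, for the cochain `p`
on the edges. -/
structure IsPotential (p : D → ZMod 2) (φ : F → V → ZMod 2) : Prop where
  symm : ∀ d, p (G.rev d) = p d
  potential : ∀ f d, G.left d = Sum.inl f →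
    φ f (G.tail (G.rev d)) = φ f (G.tail d) + p d

/-- A section, over a map `h` into the cylinder, of the double cover that is glued from trivial
covers of the open stars, with the transition functions given by differences of the potentials:
`σ y v` is the sheet of the section at `y` in the trivialization over the star of `v`. -/
structure IsSheet {Y : Type*} [TopologicalSpace Y] (φ : F → V → ZMod 2) (h : Y → X)
    (σ : Y → V → ZMod 2) : Prop where
  cont : ∀ v, ContinuousOn (fun y => σ y v) (h ⁻¹' G.star v)
  change : ∀ y u v f, h y ∈ G.star u → h y ∈ G.star v → h y ∈ G.closedFace f →
    σ y v = σ y u + (φ f v + φ f u)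

variable {G} {p : D → ZMod 2} {φ : F → V → ZMod 2}

theorem IsSheet.comp {Y Z : Type*} [TopologicalSpace Y] [TopologicalSpace Z] {h : Y → X}
    {σ : Y → V → ZMod 2} (hσ : G.IsSheet φ h σ) {g : Z → Y} (hg : Continuous g) :
    G.IsSheet φ (h ∘ g) (fun z => σ (g z)) :=
  ⟨fun v => (hσ.cont v).comp hg.continuousOn fun _ hz => hz, fun z => hσ.change (g z)⟩

theorem IsPotential.of_left_or (hφ : G.IsPotential p φ) {f : F} {d : D}
    (h : G.left d = Sum.inl f ∨ G.left (G.rev d) = Sum.inl f) :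
    φ f (G.tail (G.rev d)) = φ f (G.tail d) + p d := by
  rcases h with h | h
  · exact hφ.potential f d h
  · have := hφ.potential f (G.rev d) h
    rw [G.rev_rev, hφ.symm] at this
    rw [this, add_assoc, CharTwo.add_self_eq_zero, add_zero]

/-- The transition functions do not depend on the face. -/
theorem IsPotential.transition_eq (hφ : G.IsPotential p φ) {x : X} {u v : V} {f g : F}
    (hu : x ∈ G.star u) (hv : x ∈ G.star v) (hf : x ∈ G.closedFace f) (hg : x ∈ G.closedFace g) :
    φ f v + φ f u = φ g v + φ g u := by
  rcases point_cases (G := G) x with ⟨w, rfl⟩ | ⟨d, t, ht, rfl⟩ | ⟨f', z, hz, rfl⟩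
  · obtain rfl := hu.1 w rfl
    obtain rfl := hv.1 w rfl
    rw [CharTwo.add_self_eq_zero, CharTwo.add_self_eq_zero]
  · have h1 := hφ.of_left_or (left_eq_of_curve_mem_closedFace ht hf)
    have h2 := hφ.of_left_or (left_eq_of_curve_mem_closedFace ht hg)
    have h3 : ∀ f, φ f (G.tail (G.rev d)) = φ f (G.tail d) + p d →
        φ f (G.tail (G.rev d)) + φ f (G.tail d) = p d ∧
        φ f (G.tail d) + φ f (G.tail (G.rev d)) = p d := by
      intro f h
      rw [h]
      generalize φ f (G.tail d) = a, p d = b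
      revert a b
      decide
    rcases hu.2.1 d ⟨t, rfl⟩ with rfl | rfl <;> rcases hv.2.1 d ⟨t, rfl⟩ with h | h
    · rw [← h, CharTwo.add_self_eq_zero, CharTwo.add_self_eq_zero]
    · rw [← h, (h3 f h1).1, (h3 g h2).1]
    · rw [← h, (h3 f h1).2, (h3 g h2).2]
    · rw [← h, CharTwo.add_self_eq_zero, CharTwo.add_self_eq_zero]
  · rw [← eq_of_cell_mem_closedFace hz hf, ← eq_of_cell_mem_closedFace hz hg]

theorem eventually_mem_closedFace [T2Space X] [Finite F] (x : X) :
    ∀ᶠ y in nhds x, ∀ f, y ∈ G.closedFace f → x ∈ G.closedFace f := by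
  rw [Filter.eventually_all]
  intro f
  by_cases h : x ∈ G.closedFace f
  · exact Filter.Eventually.of_forall fun _ _ => h
  · filter_upwards [(G.isClosed_closedFace f).isOpen_compl.mem_nhds h] with y hy hy'
    exact absurd hy' hy

/-- The double cover defined by the transition functions. -/
def doubleCover [T2Space X] [Finite V] [Finite F] (hex : ∀ v, ∃ d, G.tail d = v)
    (hφ : G.IsPotential p φ) : FiberBundleCore V X (ZMod 2) where
  baseSet := G.star
  isOpen_baseSet := G.isOpen_star
  indexAt x := (exists_mem_star hex x).choose
  mem_baseSet_at x := (exists_mem_star hex x).choose_spec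
  coordChange u v x b :=
    b + (φ (exists_mem_closedFace (G := G) x).choose v +
      φ (exists_mem_closedFace (G := G) x).choose u)
  coordChange_self u x _ b := by rw [CharTwo.add_self_eq_zero, add_zero]
  continuousOn_coordChange u v := by
    rintro ⟨x, b⟩ ⟨⟨hu, hv⟩, -⟩
    have hx := (exists_mem_closedFace (G := G) x).choose_spec
    have hev : ∀ᶠ q : X × ZMod 2 in nhds (x, b), ∀ f, q.1 ∈ G.closedFace f →
        x ∈ G.closedFace f :=
      (continuous_fst.tendsto (x, b)).eventually (eventually_mem_closedFace x)
    refine ContinuousWithinAt.congr_of_eventuallyEq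
      (f := fun q : X × ZMod 2 => q.2 + (φ (exists_mem_closedFace (G := G) x).choose v +
        φ (exists_mem_closedFace (G := G) x).choose u))
      (Continuous.continuousWithinAt (by fun_prop)) ?_ rfl
    filter_upwards [nhdsWithin_le_nhds hev] with q hq
    rw [hφ.transition_eq hu hv (hq _ (exists_mem_closedFace (G := G) q.1).choose_spec) hx]
  coordChange_comp u v w x _ b := by
    generalize φ (exists_mem_closedFace (G := G) x).choose u = a,
      φ (exists_mem_closedFace (G := G) x).choose v = c,
      φ (exists_mem_closedFace (G := G) x).choose w = e
    revert a b c e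
    decide

/-- The double cover has a section over every map from a simply connected space. -/
theorem exists_isSheet [T2Space X] [Finite V] [Finite F] (hex : ∀ v, ∃ d, G.tail d = v)
    (hφ : G.IsPotential p φ) {Y : Type*} [TopologicalSpace Y] [SimplyConnectedSpace Y]
    [LocallyPathConnectedSpace Y] (h : C(Y, X)) : ∃ σ, G.IsSheet φ h σ := by
  let Z := doubleCover hex hφ
  have hcov : IsCoveringMap Z.proj := FiberBundle.isCoveringMap (E := Z.Fiber)
  let y₀ : Y := Classical.arbitrary Y
  obtain ⟨Ψ, ⟨-, hΨ⟩, -⟩ := hcov.existsUnique_continuousMap_lifts h y₀ ⟨h y₀, (0 : ZMod 2)⟩ rfl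
  have hΨ' : ∀ y, (Ψ y).proj = h y := congrFun hΨ
  refine ⟨fun y v => (Z.localTriv v (Ψ y)).2, fun v => ?_, fun y u v f hu hv hf => ?_⟩
  · refine continuous_snd.comp_continuousOn
      ((Z.localTriv v).continuousOn.comp Ψ.continuous.continuousOn fun y hy => ?_)
    rw [Z.mem_localTriv_source]
    change (Ψ y).proj ∈ G.star v
    rw [hΨ']
    exact hy
  · have h1 := Z.coordChange_comp (Z.indexAt (Ψ y).proj) u v (Ψ y).proj
      ⟨⟨Z.mem_baseSet_at _, by change (Ψ y).proj ∈ G.star u; rwa [hΨ']⟩,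
        by change (Ψ y).proj ∈ G.star v; rwa [hΨ']⟩ (Ψ y).2
    simp only [FiberBundleCore.localTriv_apply]
    rw [← h1]
    change _ + _ = _
    congr 1
    refine hφ.transition_eq hu hv ?_ hf
    rw [← hΨ']
    exact (exists_mem_closedFace (G := G) (Ψ y).proj).choose_spec

/-- Along an edge, a section changes by the value of the cochain on that edge. -/
theorem IsSheet.curve (hex : ∀ v, ∃ d, G.tail d = v) (hφ : G.IsPotential p φ) {d : D}
    {σ : unitInterval → V → ZMod 2} (hσ : G.IsSheet φ (G.curve d) σ) :
    σ 1 (G.tail (G.rev d)) = σ 0 (G.tail d) + p d := by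
  have hhalf : (⟨1 / 2, by norm_num, by norm_num⟩ : unitInterval) ∈
      Set.Ioo (0 : unitInterval) 1 := by
    constructor <;> rw [← Subtype.coe_lt_coe] <;> norm_num
  set m : unitInterval := ⟨1 / 2, by norm_num, by norm_num⟩
  have h0 : ∀ t ∈ Set.Iio (1 : unitInterval), G.curve d t ∈ G.star (G.tail d) := by
    intro t ht
    rcases unitInterval_cases t with rfl | rfl | h
    · rw [G.curve_zero]
      exact pos_mem_star hex _
    · exact absurd ht (by simp)
    · exact curve_mem_star_tail h
  have h1 : ∀ t ∈ Set.Ioi (0 : unitInterval), G.curve d t ∈ G.star (G.tail (G.rev d)) := by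
    intro t ht
    rcases unitInterval_cases t with rfl | rfl | h
    · exact absurd ht (by simp)
    · rw [G.curve_one]
      exact pos_mem_star hex _
    · exact curve_mem_star_head h
  have e0 : σ 0 (G.tail d) = σ m (G.tail d) :=
    isPreconnected_Iio.constant ((hσ.cont (G.tail d)).mono h0) (hhalf.1.trans hhalf.2) hhalf.2
  have e1 : σ m (G.tail (G.rev d)) = σ 1 (G.tail (G.rev d)) :=
    isPreconnected_Ioi.constant ((hσ.cont (G.tail (G.rev d))).mono h1) hhalf.1
      (hhalf.1.trans hhalf.2)
  obtain ⟨f, hf⟩ := exists_mem_closedFace (G := G) (G.curve d m)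
  have e2 := hσ.change m (G.tail d) (G.tail (G.rev d)) f (h0 m hhalf.2) (h1 m hhalf.1) hf
  rw [← e1, e2, e0, hφ.of_left_or (left_eq_of_curve_mem_closedFace hhalf hf)]
  generalize σ m (G.tail d) = a, φ f (G.tail d) = b, p d = c
  revert a b c
  decide

/-- Two sections over the same map from a connected space differ by a constant. -/
theorem IsSheet.exists_eq_add [T2Space X] [Finite V] [Finite F] (hex : ∀ v, ∃ d, G.tail d = v)
    {Y : Type*} [TopologicalSpace Y] [PreconnectedSpace Y] {h : Y → X} (hh : Continuous h)
    {σ τ : Y → V → ZMod 2} (hσ : G.IsSheet φ h σ) (hτ : G.IsSheet φ h τ) :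
    ∃ ε : ZMod 2, ∀ y v, h y ∈ G.star v → τ y v = σ y v + ε := by
  let c : Y → ZMod 2 := fun y => τ y (exists_mem_star hex (h y)).choose +
    σ y (exists_mem_star hex (h y)).choose
  have hc : ∀ y v, h y ∈ G.star v → c y = τ y v + σ y v := by
    intro y v hv
    obtain ⟨f, hf⟩ := exists_mem_closedFace (G := G) (h y)
    have hu := (exists_mem_star hex (h y)).choose_spec
    simp only [c]
    rw [hσ.change y _ v f hu hv hf, hτ.change y _ v f hu hv hf]
    generalize σ y (exists_mem_star hex (h y)).choose = a,
      τ y (exists_mem_star hex (h y)).choose = b,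
      φ f v + φ f (exists_mem_star hex (h y)).choose = e
    revert a b e
    decide
  have hcont : Continuous c := by
    rw [continuous_iff_continuousAt]
    intro y
    obtain ⟨v, hv⟩ := exists_mem_star hex (h y)
    have hnhds : h ⁻¹' G.star v ∈ nhds y := ((G.isOpen_star v).preimage hh).mem_nhds hv
    have : ContinuousAt (fun y => τ y v + σ y v) y :=
      ((hτ.cont v).continuousAt hnhds).add ((hσ.cont v).continuousAt hnhds)
    refine this.congr ?_
    filter_upwards [hnhds] with y' hy'
    exact (hc y' v hy').symm
  rcases isEmpty_or_nonempty Y with hY | ⟨⟨y₀⟩⟩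
  · exact ⟨0, fun y => hY.elim y⟩
  · refine ⟨c y₀, fun y v hv => ?_⟩
    rw [PreconnectedSpace.constant ‹_› hcont (x := y₀) (y := y), hc y v hv]
    generalize σ y v = a, τ y v = b
    revert a b
    decide

end Sheets

end CellDecomposition

namespace CellDecomposition

/-! ### The Euler characteristic -/

section Euler

open scoped Classical

variable {X : Type*} [TopologicalSpace X] {Φ : X ≃ₜ Cylinder} {V D F : Type*}
  [Fintype D] {G : CellDecomposition Φ V D F}

theorem exists_isPotential (p : D → ZMod 2) (hp : ∀ d, p (G.rev d) = p d)
    (hf : ∀ f : F, ∑ d ∈ G.cornersOf (Sum.inl f), p d = 0) : ∃ φ, G.IsPotential p φ := by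
  obtain ⟨φ, hφ⟩ := G.exists_face_potential p hf
  exact ⟨φ, hp, hφ⟩

/-- The universal cover of the cylinder, extended to the plane by clamping the height. -/
def unroll (Φ : X ≃ₜ Cylinder) : C(ℝ × ℝ, X) where
  toFun y := Φ.symm ((y.1 : UnitAddCircle), Set.projIcc 0 1 zero_le_one y.2)
  continuous_toFun := by
    refine Φ.symm.continuous.comp (Continuous.prodMk ?_ ?_)
    · exact (AddCircle.continuous_mk' 1).comp continuous_fst
    · exact continuous_projIcc.comp continuous_snd

theorem unroll_add_one (a h : ℝ) : unroll Φ (a + 1, h) = unroll Φ (a, h) := by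
  have : ((a + 1 : ℝ) : UnitAddCircle) = (a : UnitAddCircle) := AddCircle.coe_add_period 1 a
  simp [unroll, this]

/-- Every edge lifts to the universal cover, between chosen lifts of its ends up to a deck
transformation, which is a translation by an integer. -/
theorem exists_lift_curve : ∃ (a h : V → ℝ) (m : D → ℤ), (∀ v, unroll Φ (a v, h v) = G.pos v) ∧
    ∀ d, ∃ Γ : C(unitInterval, ℝ × ℝ), (∀ t, unroll Φ (Γ t) = G.curve d t) ∧
      Γ 0 = (a (G.tail d), h (G.tail d)) ∧
      Γ 1 = (a (G.tail (G.rev d)) + m d, h (G.tail (G.rev d))) := by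
  have hsurj : ∀ v, ∃ a : ℝ, (a : UnitAddCircle) = (Φ (G.pos v)).1 := fun v =>
    QuotientAddGroup.mk_surjective _
  choose a ha using hsurj
  let h : V → ℝ := fun v => ((Φ (G.pos v)).2 : ℝ)
  have hex : ∀ d, ∃ (m : ℤ) (Γ : C(unitInterval, ℝ × ℝ)),
      (∀ t, unroll Φ (Γ t) = G.curve d t) ∧ Γ 0 = (a (G.tail d), h (G.tail d)) ∧
      Γ 1 = (a (G.tail (G.rev d)) + m, h (G.tail (G.rev d))) := by
    intro d
    let θ : C(unitInterval, UnitAddCircle) :=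
      ⟨fun t => (Φ (G.curve d t)).1,
        continuous_fst.comp (Φ.continuous.comp (G.curve d).continuous)⟩
    obtain ⟨Θ, hΘ, hΘ0⟩ := (AddCircle.isCoveringMap_coe (1 : ℝ)).exists_path_lifts θ
      (a (G.tail d)) (by
        change (Φ (G.curve d 0)).1 = _
        rw [G.curve_zero, ← ha])
    have hΘ' : ∀ t, (Θ t : UnitAddCircle) = (Φ (G.curve d t)).1 := fun t => congrFun hΘ t
    have h1 : (Θ 1 : UnitAddCircle) = (a (G.tail (G.rev d)) : UnitAddCircle) := by
      rw [hΘ', G.curve_one, ha]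
    have h2 : ((Θ 1 - a (G.tail (G.rev d)) : ℝ) : UnitAddCircle) = 0 := by
      rw [AddCircle.coe_sub, h1, sub_self]
    obtain ⟨m, hm⟩ := (AddCircle.coe_eq_zero_iff (1 : ℝ)).1 h2
    refine ⟨m, ⟨fun t => (Θ t, ((Φ (G.curve d t)).2 : ℝ)), ?_⟩, fun t => ?_, ?_, ?_⟩
    · exact Θ.continuous.prodMk (continuous_subtype_val.comp (continuous_snd.comp
        (Φ.continuous.comp (G.curve d).continuous)))
    · change Φ.symm ((Θ t : UnitAddCircle),
        Set.projIcc 0 1 zero_le_one ((Φ (G.curve d t)).2 : ℝ)) = _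
      rw [hΘ', Set.projIcc_val]
      exact Φ.symm_apply_apply _
    · change (Θ 0, ((Φ (G.curve d 0)).2 : ℝ)) = _
      rw [hΘ0, G.curve_zero]
    · change (Θ 1, ((Φ (G.curve d 1)).2 : ℝ)) = _
      rw [G.curve_one]
      have : Θ 1 = a (G.tail (G.rev d)) + m := by
        rw [zsmul_eq_mul, mul_one] at hm
        linarith
      rw [this]
  choose m hm using hex
  refine ⟨a, h, m, fun v => ?_, hm⟩
  change Φ.symm ((a v : UnitAddCircle), Set.projIcc 0 1 zero_le_one _) = _
  rw [ha, Set.projIcc_val]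
  exact Φ.symm_apply_apply _

/-- The cellular cohomology of the cylinder modulo two in degree one is at most one-dimensional:
up to a multiple of a fixed cochain `m`, every cocycle is a coboundary. -/
theorem exists_cocycle_generator [T2Space X] [Finite V] [Finite F]
    (hex : ∀ v, ∃ d, G.tail d = v) :
    ∃ m : D → ZMod 2, ∀ p : D → ZMod 2, (∀ d, p (G.rev d) = p d) →
      (∀ f : F, ∑ d ∈ G.cornersOf (Sum.inl f), p d = 0) →
      ∃ (q : V → ZMod 2) (ε : ZMod 2), ∀ d, p d = q (G.tail d) + q (G.tail (G.rev d)) + ε * m d := by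
  obtain ⟨a, h, m, hpos, hΓ⟩ := exists_lift_curve (G := G)
  refine ⟨fun d => (m d : ZMod 2), fun p hp hf => ?_⟩
  obtain ⟨φ, hφ⟩ := exists_isPotential p hp hf
  obtain ⟨σ, hσ⟩ := exists_isSheet hex hφ (unroll Φ)
  have hτ : G.IsSheet φ (unroll Φ) (fun y => σ (y.1 + 1, y.2)) := by
    have h1 := hσ.comp (g := fun y : ℝ × ℝ => (y.1 + 1, y.2)) (by fun_prop)
    have h2 : (unroll Φ) ∘ (fun y : ℝ × ℝ => (y.1 + 1, y.2)) = unroll Φ :=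
      funext fun y => unroll_add_one _ _
    rwa [h2] at h1
  obtain ⟨ε, hε⟩ := hσ.exists_eq_add hex (unroll Φ).continuous hτ
  -- `ε` is the monodromy of the double cover around the cylinder.
  have hper : ∀ (n : ℤ) (v : V), unroll Φ (a v + n, h v) = G.pos v ∧
      σ (a v + n, h v) v = σ (a v, h v) v + n * ε := by
    intro n v
    induction n with
    | zero => simp [hpos]
    | succ n ih =>
      have h1 := hε (a v + n, h v) v (by
        have := ih.1
        push_cast at this
        rw [this]
        exact pos_mem_star hex v)
      have h2 := ih.2
      have h3 := ih.1
      push_cast at h2 h3 ⊢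
      refine ⟨?_, ?_⟩
      · rw [← add_assoc, unroll_add_one, h3]
      · rw [← add_assoc, h1, h2]
        ring
    | pred n ih =>
      have h2 := ih.2
      have h3 := ih.1
      push_cast at h2 h3 ⊢
      have h4 : a v + -(n : ℝ) = a v + (-(n : ℝ) - 1) + 1 := by ring
      rw [h4] at h2 h3
      rw [unroll_add_one] at h3
      have h1 := hε (a v + (-(n : ℝ) - 1), h v) v (by rw [h3]; exact pos_mem_star hex v)
      refine ⟨h3, ?_⟩
      rw [h1] at h2
      rw [← add_left_inj ε, h2]
      ring
  refine ⟨fun v => σ (a v, h v) v, ε, fun d => ?_⟩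
  obtain ⟨Γ, hΓc, hΓ0, hΓ1⟩ := hΓ d
  have h1 := hσ.comp Γ.continuous
  have h2 : (unroll Φ) ∘ Γ = G.curve d := funext hΓc
  rw [h2] at h1
  have h3 := h1.curve hex hφ
  rw [hΓ0, hΓ1, (hper _ _).2] at h3
  dsimp only
  generalize σ (a (G.tail d), h (G.tail d)) (G.tail d) = x, p d = y, (m d : ZMod 2) = n,
    σ (a (G.tail (G.rev d)), h (G.tail (G.rev d))) (G.tail (G.rev d)) = z at h3 ⊢
  clear hε hper
  revert x y n z ε
  decide

/-- The inequality for the Euler characteristic that bounds the genus: there are at least half as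
many internal faces as vertices. Indeed, there are at least `|D| / 2 - |F|` independent cocycles, but
at most `|V| - 1` independent coboundaries. -/
theorem card_vertices_le [T2Space X] [Fintype V] [Fintype F] [Nonempty V]
    (htri : ∀ u, Nat.card {d // G.tail d = u} = 3) :
    Fintype.card V ≤ 2 * Fintype.card F := by
  obtain ⟨m, hm⟩ := exists_cocycle_generator (G := G) (exists_tail_eq htri)
  let T : (D → ZMod 2) →ₗ[ZMod 2] (D → ZMod 2) :=
    { toFun := fun p d => p d + p (G.rev d)
      map_add' := fun p q => by funext d; simp only [Pi.add_apply]; ring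
      map_smul' := fun c p => by
        funext d; simp only [Pi.smul_apply, smul_eq_mul, RingHom.id_apply]; ring }
  let S : (LinearMap.ker T) →ₗ[ZMod 2] (F → ZMod 2) :=
    { toFun := fun p f => ∑ d ∈ G.cornersOf (Sum.inl f), (p : D → ZMod 2) d
      map_add' := fun p q => by funext f; simp [Finset.sum_add_distrib]
      map_smul' := fun c p => by funext f; simp [Finset.mul_sum] }
  let W : ((V → ZMod 2) × ZMod 2) →ₗ[ZMod 2] (D → ZMod 2) :=
    { toFun := fun y d => y.1 (G.tail d) + y.1 (G.tail (G.rev d)) + y.2 * m d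
      map_add' := fun p q => by
        funext d; simp only [Prod.fst_add, Prod.snd_add, Pi.add_apply]; ring
      map_smul' := fun c p => by
        funext d
        simp only [Prod.smul_fst, Prod.smul_snd, Pi.smul_apply, smul_eq_mul, RingHom.id_apply]
        ring }
  have hT := LinearMap.finrank_range_add_finrank_ker T
  have hS := LinearMap.finrank_range_add_finrank_ker S
  have hW := LinearMap.finrank_range_add_finrank_ker W
  rw [Module.finrank_fintype_fun_eq_card, card_edges htri] at hT
  rw [Module.finrank_prod, Module.finrank_fintype_fun_eq_card, Module.finrank_self] at hW
  have hTT : LinearMap.range T ≤ LinearMap.ker T := by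
    rintro _ ⟨p, rfl⟩
    rw [LinearMap.mem_ker]
    funext d
    change (p d + p (G.rev d)) + (p (G.rev d) + p (G.rev (G.rev d))) = 0
    rw [G.rev_rev, add_comm (p (G.rev d)), CharTwo.add_self_eq_zero]
  have h1 := Submodule.finrank_mono hTT
  have h2 : Module.finrank (ZMod 2) (LinearMap.range S) ≤ Fintype.card F := by
    have := Submodule.finrank_le (LinearMap.range S)
    rwa [Module.finrank_fintype_fun_eq_card] at this
  have h3 : 0 < Module.finrank (ZMod 2) (LinearMap.ker W) := by
    rw [Module.finrank_pos_iff_exists_ne_zero]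
    refine ⟨⟨(1, 0), ?_⟩, fun h => ?_⟩
    · rw [LinearMap.mem_ker]
      funext d
      change (1 : ZMod 2) + 1 + 0 * m d = 0
      rw [zero_mul, add_zero, CharTwo.add_self_eq_zero]
    · have h' := congrFun (congrArg Prod.fst (congrArg Subtype.val h)) (Classical.arbitrary V)
      exact one_ne_zero h'
  have h4 : (LinearMap.ker S).map (LinearMap.ker T).subtype ≤ LinearMap.range W := by
    rintro _ ⟨⟨p, hpT⟩, hpS, rfl⟩
    have hp1 : ∀ d, p (G.rev d) = p d := fun d =>
      (CharTwo.add_eq_zero.1 (congrFun (LinearMap.mem_ker.1 hpT) d)).symm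
    obtain ⟨q, ε, hq⟩ := hm p hp1 fun f => congrFun (LinearMap.mem_ker.1 hpS) f
    exact ⟨(q, ε), funext fun d => (hq d).symm⟩
  have h5 := Submodule.finrank_mono h4
  rw [← (Submodule.equivMapOfInjective _ (Submodule.injective_subtype _) _).finrank_eq] at h5
  omega

end Euler

end CellDecomposition

/-! ### Lengths of curves and short closed walks -/

theorem edist_le_curveLength {X : Type*} [MetricSpace X] (γ : unitInterval → X) :
    edist (γ 0) (γ 1) ≤ curveLength γ :=
  eVariationOn.edist_le γ trivial trivial

theorem curveLength_trans_le {X : Type*} [MetricSpace X] {x y z : X} (γ : Path x y)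
    (δ : Path y z) : curveLength (γ.trans δ) ≤ curveLength γ + curveLength δ := by
  set m : unitInterval := ⟨1 / 2, by norm_num, by norm_num⟩
  have hu : (Set.univ : Set unitInterval) = Set.Iic m ∪ Set.Ici m := Set.Iic_union_Ici.symm
  have hl : eVariationOn (γ.trans δ) (Set.Iic m) ≤ curveLength γ := by
    have h : Set.EqOn (γ.trans δ)
        (γ ∘ fun t : unitInterval => Set.projIcc 0 1 zero_le_one (2 * (t : ℝ))) (Set.Iic m) := by
      intro t ht
      have ht' : (t : ℝ) ≤ 1 / 2 := ht
      simp only [Function.comp_apply]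
      rw [Path.trans_apply, dif_pos ht', Set.projIcc_of_mem]
    rw [eVariationOn.congr h]
    refine eVariationOn.comp_le_of_monotoneOn γ _ ?_ fun _ _ => trivial
    intro s _ t _ hst
    have hst' : (s : ℝ) ≤ t := hst
    exact Set.monotone_projIcc _ (by linarith)
  have hr : eVariationOn (γ.trans δ) (Set.Ici m) ≤ curveLength δ := by
    have h : Set.EqOn (γ.trans δ)
        (δ ∘ fun t : unitInterval => Set.projIcc 0 1 zero_le_one (2 * (t : ℝ) - 1))
        (Set.Ici m) := by
      intro t ht
      have ht' : 1 / 2 ≤ (t : ℝ) := ht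
      simp only [Function.comp_apply]
      rw [Path.trans_apply]
      split_ifs with h
      · have h1 : (t : ℝ) = 1 / 2 := le_antisymm h ht'
        have h2 : (⟨2 * (t : ℝ), (unitInterval.mul_pos_mem_iff zero_lt_two).2 ⟨t.2.1, h⟩⟩ :
            unitInterval) = 1 := Subtype.ext (by simp [h1])
        have h3 : Set.projIcc (0 : ℝ) 1 zero_le_one (2 * (t : ℝ) - 1) = 0 := by
          rw [h1]
          exact Set.projIcc_of_le_left _ (by norm_num)
        rw [h2, h3, γ.target, δ.source]
      · rw [Set.projIcc_of_mem]
    rw [eVariationOn.congr h]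
    refine eVariationOn.comp_le_of_monotoneOn δ _ ?_ fun _ _ => trivial
    intro s _ t _ hst
    have hst' : (s : ℝ) ≤ t := hst
    exact Set.monotone_projIcc _ (by linarith)
  rw [curveLength, hu, eVariationOn.union _ isGreatest_Iic isLeast_Ici]
  exact add_le_add hl hr

namespace CellDecomposition

section ShortWalks

variable {X : Type*} [MetricSpace X] {Φ : X ≃ₜ Cylinder} {V D F : Type*}
  [Fintype D] {G : CellDecomposition Φ V D F}

theorem dist_le_of_edgeWalk {ℓ : ℝ} (hℓ0 : 0 ≤ ℓ)
    (hℓ : ∀ d, curveLength (G.curve d) ≤ ENNReal.ofReal ℓ) {u v : V} {n : ℕ}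
    (h : G.EdgeWalk u v n) : dist (G.pos u) (G.pos v) ≤ n * ℓ := by
  induction h with
  | nil => simp
  | @cons d v n _ ih =>
    have h1 : dist (G.pos (G.tail d)) (G.pos (G.tail (G.rev d))) ≤ ℓ := by
      have h2 := (edist_le_curveLength (G.curve d)).trans (hℓ d)
      rw [G.curve_zero, G.curve_one, edist_dist] at h2
      exact (ENNReal.ofReal_le_ofReal_iff hℓ0).1 h2
    calc dist (G.pos (G.tail d)) (G.pos v)
        ≤ dist (G.pos (G.tail d)) (G.pos (G.tail (G.rev d))) +
          dist (G.pos (G.tail (G.rev d))) (G.pos v) := dist_triangle _ _ _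
      _ ≤ ℓ + n * ℓ := add_le_add h1 ih
      _ = ((n + 1 : ℕ) : ℝ) * ℓ := by push_cast; ring

/-- The curve traced by a walk. A section of the double cover of the constant cochain `1` changes
along it by the number of its edges. -/
theorem exists_path_of_edgeWalk (hex : ∀ v, ∃ d, G.tail d = v) {φ : F → V → ZMod 2}
    (hφ : G.IsPotential (fun _ => 1) φ) {ℓ : ℝ≥0∞} (hℓ : ∀ d, curveLength (G.curve d) ≤ ℓ)
    {u v : V} {n : ℕ} (h : G.EdgeWalk u v n) : ∃ γ : Path (G.pos u) (G.pos v),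
      curveLength γ ≤ n * ℓ ∧ ∀ σ, G.IsSheet φ γ σ → σ 1 v = σ 0 u + n := by
  induction h with
  | nil v =>
    refine ⟨Path.refl _, ?_, fun σ hσ => ?_⟩
    · have : curveLength (Path.refl (G.pos v)) = 0 :=
        eVariationOn.constant_on (by
          rintro _ ⟨s, _, rfl⟩ _ ⟨t, _, rfl⟩
          rfl)
      rw [this]
      exact zero_le
    · have hc : ContinuousOn (fun t => σ t v) Set.univ :=
        (hσ.cont v).mono fun t _ => pos_mem_star hex v
      rw [Nat.cast_zero, add_zero]
      exact isPreconnected_univ.constant hc trivial trivial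
  | @cons d v n _ ih =>
    obtain ⟨δ, hδ, hδσ⟩ := ih
    let ε : Path (G.pos (G.tail d)) (G.pos (G.tail (G.rev d))) :=
      ⟨G.curve d, G.curve_zero d, G.curve_one d⟩
    refine ⟨ε.trans δ, (curveLength_trans_le ε δ).trans ?_, fun σ hσ => ?_⟩
    · have h1 : curveLength ε ≤ ℓ := hℓ d
      refine (add_le_add h1 hδ).trans (le_of_eq ?_)
      push_cast
      ring
    · let g₁ : unitInterval → unitInterval := fun t => ⟨(t : ℝ) / 2, by
        have := t.2.1; positivity, by have := t.2.2; linarith⟩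
      let g₂ : unitInterval → unitInterval := fun t => ⟨((t : ℝ) + 1) / 2, by
        have := t.2.1; positivity, by have := t.2.2; linarith⟩
      have hg₁ : Continuous g₁ := by fun_prop
      have hg₂ : Continuous g₂ := by fun_prop
      have e₁ : (ε.trans δ) ∘ g₁ = G.curve d := by
        funext t
        have ht : ((g₁ t : unitInterval) : ℝ) ≤ 1 / 2 := by
          have := t.2.2
          change (t : ℝ) / 2 ≤ 1 / 2
          linarith
        rw [Function.comp_apply, Path.trans_apply, dif_pos ht]
        change G.curve d _ = _
        congr 1
        exact Subtype.ext (by change 2 * ((t : ℝ) / 2) = t; ring)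
      have e₂ : (ε.trans δ) ∘ g₂ = δ := by
        funext t
        rw [Function.comp_apply, Path.trans_apply]
        split_ifs with ht
        · have ht' : ((t : ℝ) + 1) / 2 ≤ 1 / 2 := ht
          have h0 : t = 0 := Subtype.ext (le_antisymm (by change (t : ℝ) ≤ 0; linarith) t.2.1)
          subst h0
          rw [δ.source]
          have : (⟨2 * (g₂ 0 : ℝ), (unitInterval.mul_pos_mem_iff zero_lt_two).2
              ⟨(g₂ 0).2.1, ht⟩⟩ : unitInterval) = 1 :=
            Subtype.ext (by change 2 * (((0 : ℝ) + 1) / 2) = 1; norm_num)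
          rw [this, ε.target]
        · congr 1
          exact Subtype.ext (by change 2 * (((t : ℝ) + 1) / 2) - 1 = t; ring)
      have s₁ := hσ.comp hg₁
      have s₂ := hσ.comp hg₂
      rw [e₁] at s₁
      rw [e₂] at s₂
      have r₁ := s₁.curve hex hφ
      have r₂ := hδσ _ s₂
      have a₀ : g₁ 0 = 0 := Subtype.ext (by change (0 : ℝ) / 2 = 0; norm_num)
      have a₁ : g₁ 1 = g₂ 0 := Subtype.ext (by change (1 : ℝ) / 2 = (0 + 1) / 2; norm_num)
      have a₂ : g₂ 1 = 1 := Subtype.ext (by change ((1 : ℝ) + 1) / 2 = 1; norm_num)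
      rw [a₀, a₁] at r₁
      rw [a₂, r₁] at r₂
      rw [r₂]
      push_cast
      ring

/-- Sections of the double cover close up along a contractible curve, since they extend over the
null homotopy. -/
theorem eq_zero_of_homotopic_refl [Finite V] [Finite F] (hex : ∀ v, ∃ d, G.tail d = v)
    {p : D → ZMod 2} {φ : F → V → ZMod 2} (hφ : G.IsPotential p φ) {u : V}
    {γ : Path (G.pos u) (G.pos u)} (hγ : γ.Homotopic (Path.refl _)) {n : ZMod 2}
    (hn : ∀ σ, G.IsSheet φ γ σ → σ 1 u = σ 0 u + n) : n = 0 := by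
  obtain ⟨H⟩ := hγ
  -- The homotopy is extended to the plane, where simple connectedness is available.
  let c : ℝ → unitInterval := Set.projIcc 0 1 zero_le_one
  have hc : Continuous c := continuous_projIcc
  have hcv : ∀ t : unitInterval, c t = t := fun t => Set.projIcc_val _ t
  let h : C(ℝ × ℝ, X) := ⟨fun y => H (c y.1, c y.2), by fun_prop⟩
  obtain ⟨σ, hσ⟩ := exists_isSheet hex hφ h
  have hconst : ∀ g : unitInterval → ℝ × ℝ, Continuous g → (∀ t, h (g t) = G.pos u) →
      σ (g 0) u = σ (g 1) u := by
    intro g hg hgu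
    have hc' : ContinuousOn (fun t => σ (g t) u) Set.univ :=
      ((hσ.comp hg).cont u).mono fun t _ => by
        change h (g t) ∈ G.star u
        rw [hgu]
        exact pos_mem_star hex u
    exact isPreconnected_univ.constant hc' trivial trivial
  have c0 : c 0 = 0 := by simpa using hcv 0
  have c1 : c 1 = 1 := by simpa using hcv 1
  have e1 := hconst (fun t => ((t : ℝ), 0)) (by fun_prop) (fun t => by
    change H (c t, c 0) = _
    rw [c0]
    exact H.source _)
  have e2 := hconst (fun t => ((t : ℝ), 1)) (by fun_prop) (fun t => by
    change H (c t, c 1) = _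
    rw [c1]
    exact H.target _)
  have e3 := hconst (fun t => (1, (t : ℝ))) (by fun_prop) (fun t => by
    change H (c 1, c t) = _
    rw [c1, H.apply_one]
    rfl)
  have hbot := hσ.comp (g := fun t : unitInterval => ((0 : ℝ), (t : ℝ))) (by fun_prop)
  have hbot' : h ∘ (fun t : unitInterval => ((0 : ℝ), (t : ℝ))) = γ := by
    funext t
    change H (c 0, c t) = _
    rw [c0, hcv, H.apply_zero]
    rfl
  rw [hbot'] at hbot
  have e4 := hn _ hbot
  simp only [Set.Icc.coe_zero, Set.Icc.coe_one] at e1 e2 e3 e4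
  rw [e2, ← e3, ← e1] at e4
  exact left_eq_add.1 e4

/-- Closed walks with an odd number of edges wind around the cylinder, so they are long. -/
theorem girth_le_of_odd_edgeWalk [Fintype V] [Finite F] (hG : G.IsAdmissible) {R L ℓ : ℝ}
    (hX : IsMetricCylinder Φ R L) (hℓ0 : 0 ≤ ℓ)
    (hℓ : ∀ d, curveLength (G.curve d) ≤ ENNReal.ofReal ℓ) {v : V} {n : ℕ}
    (h : G.EdgeWalk v v n) (hn : Odd n) : R ≤ n * ℓ := by
  classical
  have hex := exists_tail_eq hG.trivalent
  obtain ⟨φ, hφ⟩ := exists_isPotential (G := G) (fun _ => 1) (fun _ => rfl) (fun f => by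
    rw [Finset.sum_const, card_cornersOf, nsmul_eq_mul, mul_one, natCast_boundaryCount_inl hG])
  obtain ⟨γ, hγ, hγσ⟩ := exists_path_of_edgeWalk hex hφ hℓ h
  have hγ0 : ¬ γ.Homotopic (Path.refl _) := by
    intro hγ0
    have := eq_zero_of_homotopic_refl hex hφ hγ0 hγσ
    rw [ZMod.natCast_eq_zero_iff_even] at this
    exact Nat.not_even_iff_odd.2 hn this
  have h1 := (hX.girth _ γ hγ0).trans hγ
  rw [← ENNReal.ofReal_natCast, ← ENNReal.ofReal_mul (Nat.cast_nonneg _)] at h1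
  exact (ENNReal.ofReal_le_ofReal_iff (by positivity)).1 h1

end ShortWalks

end CellDecomposition

namespace CellDecomposition

/-! ### Logical operators of a color code -/

section Logical

open scoped Classical

variable {X : Type*} [TopologicalSpace X] {Φ : X ≃ₜ Cylinder} {V D F : Type*}
  [Fintype D] {G : CellDecomposition Φ V D F}

theorem supportVec_injective : Function.Injective (supportVec (V := V)) := by
  intro A B h
  ext v
  have := congrFun h v
  by_cases hA : v ∈ A <;> by_cases hB : v ∈ B <;> simp [supportVec, hA, hB] at this ⊢

theorem supportVec_symmDiff [DecidableEq V] (A B : Finset V) :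
    supportVec (symmDiff A B) = supportVec A + supportVec B := by
  funext v
  by_cases hA : v ∈ A <;> by_cases hB : v ∈ B <;>
    simp [supportVec, Finset.mem_symmDiff, hA, hB, CharTwo.add_self_eq_zero]

theorem injOn_tail_cornersOf (f : F) :
    Set.InjOn G.tail (G.cornersOf (Sum.inl f) : Set D) := fun _ hd _ he h =>
  G.eq_of_left_eq_of_tail_eq (G.mem_cornersOf.1 hd) (G.mem_cornersOf.1 he) h

theorem exists_boundary_vertex {A : Finset V} {i : Fin 2}
    (h : G.faceSum (supportVec A) (Sum.inr i) ≠ 0) :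
    ∃ d, G.left d = Sum.inr i ∧ G.tail d ∈ A := by
  obtain ⟨d, hd, hdA⟩ := Finset.exists_ne_zero_of_sum_ne_zero h
  refine ⟨d, G.mem_cornersOf.1 hd, ?_⟩
  by_contra hA
  exact hdA (if_neg hA)

variable [Fintype V]

theorem exists_supportVec_eq (x : V → ZMod 2) : ∃ A : Finset V, supportVec A = x := by
  refine ⟨Finset.univ.filter fun v => x v = 1, funext fun v => ?_⟩
  simp only [supportVec, Finset.mem_filter, Finset.mem_univ, true_and]
  generalize x v = a
  revert a
  decide

theorem faceVertices_eq_image (f : F) :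
    G.faceVertices f = (G.cornersOf (Sum.inl f)).image G.tail := by
  ext v
  simp [faceVertices, and_comm]

theorem even_card_faceVertices (hG : G.IsAdmissible) (f : F) :
    Even (G.faceVertices f).card := by
  rw [faceVertices_eq_image, Finset.card_image_of_injOn (injOn_tail_cornersOf f), card_cornersOf]
  exact hG.even_faces f

theorem sum_faceVertices (f : F) (h : V → ZMod 2) :
    ∑ v ∈ G.faceVertices f, h v = ∑ d ∈ G.cornersOf (Sum.inl f), h (G.tail d) := by
  rw [faceVertices_eq_image, Finset.sum_image (injOn_tail_cornersOf f)]

theorem supportVec_faceVertices [Fintype F] (f : F) :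
    supportVec (G.faceVertices f) = G.vertexSum (Pi.single (Sum.inl f) 1) := by
  funext v
  simp only [vertexSum, supportVec, Pi.single_apply]
  by_cases h : v ∈ G.faceVertices f
  · obtain ⟨d, rfl, hd⟩ := (Finset.mem_filter.1 h).2
    rw [if_pos h, Finset.sum_boole, Finset.card_eq_one.2 ⟨d, ?_⟩, Nat.cast_one]
    ext e
    simp only [Finset.mem_filter, mem_cornersAt, Finset.mem_singleton]
    exact ⟨fun he => G.eq_of_left_eq_of_tail_eq he.2 hd he.1, fun he => by subst he; exact ⟨rfl, hd⟩⟩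
  · rw [if_neg h, Finset.sum_eq_zero]
    intro d hd
    rw [if_neg]
    intro hl
    exact h (Finset.mem_filter.2 ⟨Finset.mem_univ _, d, G.mem_cornersAt.1 hd, hl⟩)

variable [LinearOrder V]

theorem faceSum_supportVec (A : Finset V) (f : F) :
    G.faceSum (supportVec A) (Sum.inl f) = (A ∩ G.faceVertices f).card := by
  rw [faceSum, ← sum_faceVertices]
  rw [Finset.inter_comm, ← Finset.filter_mem_eq_inter, Finset.card_filter, Nat.cast_sum]
  refine Finset.sum_congr rfl fun v _ => ?_
  by_cases hv : v ∈ A <;> simp [supportVec, hv]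

variable {S : Subgroup (MajoranaAlgebra V)ˣ} {C : F → (MajoranaAlgebra V)ˣ}

/-- An operator commutes with a color code if its support overlaps evenly with all faces. -/
theorem commute_of_faceSum_eq_zero (hG : G.IsAdmissible)
    (hC : ∀ f, HasSupport (C f) (G.faceVertices f)) {P : (MajoranaAlgebra V)ˣ} {A : Finset V}
    (hP : HasSupport P A) (hA : ∀ f, G.faceSum (supportVec A) (Sum.inl f) = 0) :
    ∀ Q ∈ Subgroup.closure (Set.range C), P * Q = Q * P := by
  have h : Subgroup.closure (Set.range C) ≤ Subgroup.centralizer {P} := by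
    rw [Subgroup.closure_le]
    rintro _ ⟨f, rfl⟩
    rw [SetLike.mem_coe, Subgroup.mem_centralizer_singleton_iff]
    have hf := hA f
    rw [faceSum_supportVec, ZMod.natCast_eq_zero_iff_even] at hf
    exact ((hP.commute_iff (hC f) (even_card_faceVertices hG f)).2 hf).symm
  intro Q hQ
  exact (Subgroup.mem_centralizer_singleton_iff.1 (h hQ)).symm

theorem faceSum_eq_zero_of_mem_codeCentralizer (hG : G.IsAdmissible)
    (hC : ∀ f, HasSupport (C f) (G.faceVertices f)) (hS : S = Subgroup.closure (Set.range C))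
    {P : (MajoranaAlgebra V)ˣ} (hPS : P ∈ codeCentralizer S) {A : Finset V}
    (hP : HasSupport P A) (f : F) : G.faceSum (supportVec A) (Sum.inl f) = 0 := by
  have hf : C f ∈ S := by
    rw [hS]
    exact Subgroup.subset_closure ⟨f, rfl⟩
  rw [faceSum_supportVec, ZMod.natCast_eq_zero_iff_even,
    ← hP.commute_iff (hC f) (even_card_faceVertices hG f)]
  exact (Subgroup.mem_centralizer_iff.1 hPS.2 _ hf).symm

/-- Sums of internal faces are the supports of elements of the code. -/
theorem exists_mem_hasSupport_of_vertexSum [Fintype F]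
    (hC : ∀ f, HasSupport (C f) (G.faceVertices f)) {x : F ⊕ Fin 2 → ZMod 2}
    (hx : ∀ i, x (Sum.inr i) = 0) {A : Finset V} (hA : G.vertexSum x = supportVec A) :
    ∃ Q ∈ Subgroup.closure (Set.range C), HasSupport Q A := by
  have key : ∀ T : Finset F, ∃ Q ∈ Subgroup.closure (Set.range C), ∃ B, HasSupport Q B ∧
      supportVec B = G.vertexSum (∑ f ∈ T, Pi.single (Sum.inl f) 1) := by
    intro T
    induction T using Finset.induction_on with
    | empty =>
      refine ⟨1, one_mem _, ∅, hasSupport_one, ?_⟩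
      funext v
      simp [supportVec, vertexSum]
    | insert f T hf ih =>
      obtain ⟨Q, hQ, B, hQB, hB⟩ := ih
      refine ⟨C f * Q, mul_mem (Subgroup.subset_closure ⟨f, rfl⟩) hQ, _, (hC f).mul hQB, ?_⟩
      rw [supportVec_symmDiff, hB, supportVec_faceVertices, Finset.sum_insert hf]
      funext v
      rw [vertexSum_add, Pi.add_apply]
  obtain ⟨Q, hQ, B, hQB, hB⟩ := key (Finset.univ.filter fun f => x (Sum.inl f) = 1)
  have hxs : ∑ f ∈ Finset.univ.filter (fun f => x (Sum.inl f) = 1),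
      (Pi.single (Sum.inl f) 1 : F ⊕ Fin 2 → ZMod 2) = x := by
    funext g
    rw [Finset.sum_apply]
    rcases g with f | i
    · simp only [Pi.single_apply, Sum.inl.injEq, Finset.sum_ite_eq, Finset.mem_filter,
        Finset.mem_univ, true_and]
      generalize x (Sum.inl f) = a
      revert a
      decide
    · rw [hx, Finset.sum_eq_zero]
      intro f _
      simp
  rw [hxs, hA] at hB
  rw [supportVec_injective hB] at hQB
  exact ⟨Q, hQ, hQB⟩

/-- The support of a logical operator is a sum of faces that involves an external face. -/
theorem IsLogical.exists_vertexSum_eq [Fintype F] (hG : G.IsAdmissible) (hc : G.IsConnected)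
    (hE : Fintype.card V ≤ 2 * Fintype.card F)
    (hC : ∀ f, HasSupport (C f) (G.faceVertices f)) (hS : S = Subgroup.closure (Set.range C))
    {P : (MajoranaAlgebra V)ˣ} (hL : IsLogical S P) {A : Finset V} (hP : HasSupport P A) :
    ∃ x, G.vertexSum x = supportVec A ∧ ¬ ∀ i, x (Sum.inr i) = 0 := by
  obtain ⟨x, hx⟩ := CellDecomposition.exists_vertexSum_eq hG hc hE
    (faceSum_eq_zero_of_mem_codeCentralizer hG hC hS hL.1 hP)
  refine ⟨x, hx, fun h => hL.2 ?_⟩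
  obtain ⟨Q, hQ, hQA⟩ := exists_mem_hasSupport_of_vertexSum hC h hx
  rw [← hS] at hQ
  exact ⟨Q, hQ, hP.exists_isPhase_eq_smul hQA⟩

/-- The total parity `c_V` is a logical operator: the product of the modes on one boundary circle
commutes with the code but not with `c_V`. -/
theorem exists_isLogical_univ [Fintype F] (hG : G.IsAdmissible)
    (hC : ∀ f, HasSupport (C f) (G.faceVertices f)) (hS : S = Subgroup.closure (Set.range C)) :
    ∃ P, IsLogical S P ∧ HasSupport P Finset.univ := by
  obtain ⟨P, hPm, hP⟩ := exists_mem_majoranaGroup_hasSupport (Finset.univ : Finset V)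
  obtain ⟨B, hB⟩ := exists_supportVec_eq (G.vertexSum (Pi.single (Sum.inr 0) 1))
  obtain ⟨T, -, hT⟩ := exists_mem_majoranaGroup_hasSupport B
  have hTS := commute_of_faceSum_eq_zero hG hC hT fun f => by
    rw [hB, faceSum_vertexSum_inl hG]
  have hPS := commute_of_faceSum_eq_zero hG hC hP fun f => by
    rw [faceSum_supportVec, Finset.univ_inter, ZMod.natCast_eq_zero_iff_even]
    exact even_card_faceVertices hG f
  rw [← hS] at hTS hPS
  refine ⟨P, ⟨⟨hPm, Subgroup.mem_centralizer_iff.2 fun Q hQ => (hPS Q hQ).symm⟩, ?_⟩, hP⟩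
  rintro ⟨Q, hQ, η, -, hPQ⟩
  have hTP : T * P = P * T := by
    have h := congrArg Units.val (hTS Q hQ)
    rw [Units.val_mul, Units.val_mul] at h
    rw [Units.ext_iff, Units.val_mul, Units.val_mul, hPQ, mul_smul_comm, h, smul_mul_assoc]
  rw [hT.commute_iff hP (by rw [Finset.card_univ]; exact hG.even_vertices), Finset.inter_univ,
    ← ZMod.natCast_eq_zero_iff_even, ← sum_supportVec, hB, sum_vertexSum hG] at hTP
  simp at hTP

end Logical

/-! ### Bounds on weight and diameter -/

section Bounds

open scoped Classical

variable {X : Type*} [MetricSpace X] {Φ : X ≃ₜ Cylinder} {V D F : Type*}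
  [Fintype D] {G : CellDecomposition Φ V D F} {R L ℓ : ℝ} {k : ℕ}

theorem height_le_dist (hX : IsMetricCylinder Φ R L) {d e : D} (hd : G.left d = Sum.inr 0)
    (he : G.left e = Sum.inr 1) : L ≤ dist (G.pos (G.tail d)) (G.pos (G.tail e)) := by
  have key : ∀ (i : Fin 2) (d : D), G.left d = Sum.inr i →
      (Φ (G.pos (G.tail d))).2 = boundaryLevel i := by
    intro i d hd
    have : G.pos (G.tail d) ∈ {x | (Φ x).2 = boundaryLevel i} := by
      rw [G.boundary_eq i]
      exact Set.mem_biUnion (show d ∈ {d | G.left d = Sum.inr i} from hd) ⟨0, G.curve_zero d⟩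
    exact this
  exact hX.height.2 ⟨_, _, key 0 d hd, key 1 e he, rfl⟩

variable [Fintype V] [Fintype F]

/-- Odd sets that overlap evenly with all faces have weight of order `R`. -/
theorem girth_le_of_odd_card (hG : G.IsAdmissible) (hc : G.IsConnected)
    (hE : Fintype.card V ≤ 2 * Fintype.card F) (hX : IsMetricCylinder Φ R L) (hℓ0 : 0 ≤ ℓ)
    (hℓ : ∀ d, curveLength (G.curve d) ≤ ENNReal.ofReal ℓ)
    (hk : ∀ f : F, G.boundaryCount (Sum.inl f) ≤ k) {A : Finset V}
    (hA : ∀ f, G.faceSum (supportVec A) (Sum.inl f) = 0) (hodd : Odd A.card) :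
    R ≤ 3 * A.card * k * ℓ := by
  by_contra hlt
  refine Nat.not_even_iff_odd.2 hodd
    (even_card_of_short_closed_walks_even hG hc hE hA hk fun v n hw hn => ?_)
  by_contra hne
  refine hlt ((girth_le_of_odd_edgeWalk hG hX hℓ0 hℓ hw (Nat.not_even_iff_odd.1 hne)).trans ?_)
  refine mul_le_mul_of_nonneg_right ?_ hℓ0
  exact_mod_cast hn

/-- A set that overlaps evenly with all faces and oddly with the first boundary circle has weight
of order `min R L`: the union of its clusters that meet this circle either reaches the second
circle, or it is odd. -/
theorem min_le_of_odd_boundary_overlap (hG : G.IsAdmissible) (hc : G.IsConnected)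
    (hE : Fintype.card V ≤ 2 * Fintype.card F) (hX : IsMetricCylinder Φ R L) (hℓ0 : 0 ≤ ℓ)
    (hℓ : ∀ d, curveLength (G.curve d) ≤ ENNReal.ofReal ℓ)
    (hk : ∀ f : F, G.boundaryCount (Sum.inl f) ≤ k) {A : Finset V}
    (hA : ∀ f, G.faceSum (supportVec A) (Sum.inl f) = 0)
    (hA0 : G.faceSum (supportVec A) (Sum.inr 0) ≠ 0) :
    min R L ≤ 3 * A.card * k * ℓ := by
  let near : V → Prop := fun v => ∃ (hv : v ∈ A) (d : D) (hd : G.tail d ∈ A),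
    G.left d = Sum.inr 0 ∧ (G.clusterGraph A).Reachable ⟨_, hd⟩ ⟨v, hv⟩
  let B : Finset V := A.filter near
  have hB0 : G.faceSum (supportVec B) (Sum.inr 0) = G.faceSum (supportVec A) (Sum.inr 0) := by
    refine Finset.sum_congr rfl fun d hd => ?_
    have hiff : G.tail d ∈ B ↔ G.tail d ∈ A :=
      ⟨fun h => (Finset.mem_filter.1 h).1, fun h =>
        Finset.mem_filter.2 ⟨h, h, d, h, G.mem_cornersOf.1 hd, SimpleGraph.Reachable.refl _⟩⟩
    simp only [supportVec, hiff]
  have hB : ∀ f, G.faceSum (supportVec B) (Sum.inl f) = 0 := by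
    intro f
    by_cases hex : ∃ e ∈ G.cornersOf (Sum.inl f), G.tail e ∈ B
    · obtain ⟨e, he, heB⟩ := hex
      obtain ⟨-, heA, d₀, hd₀, hl₀, hr⟩ := Finset.mem_filter.1 heB
      rw [← hA f]
      refine Finset.sum_congr rfl fun d hd => ?_
      have hiff : G.tail d ∈ B ↔ G.tail d ∈ A :=
        ⟨fun h => (Finset.mem_filter.1 h).1, fun h => Finset.mem_filter.2 ⟨h, h, d₀, hd₀, hl₀,
          hr.trans (reachable_clusterGraph (G.mem_cornersOf.1 he) (G.mem_cornersOf.1 hd) heA h)⟩⟩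
      simp only [supportVec, hiff]
    · refine Finset.sum_eq_zero fun d hd => if_neg fun h => hex ⟨d, hd, h⟩
  have hBA : B.card ≤ A.card := Finset.card_filter_le _ _
  by_cases hB1 : G.faceSum (supportVec B) (Sum.inr 1) = 0
  · have hodd : Odd B.card := by
      obtain ⟨x, hx⟩ := exists_vertexSum_eq hG hc hE hB
      rw [← ZMod.natCast_ne_zero_iff_odd, ← sum_supportVec, ← hx, sum_vertexSum hG,
        ← faceSum_vertexSum_inr hG x 0, ← faceSum_vertexSum_inr hG x 1, hx, hB1, add_zero, hB0]
      exact hA0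
    refine (min_le_left _ _).trans
      ((girth_le_of_odd_card hG hc hE hX hℓ0 hℓ hk hB hodd).trans ?_)
    gcongr
  · obtain ⟨e, he, heB⟩ := exists_boundary_vertex hB1
    obtain ⟨-, heA, d, hd, hl, hr⟩ := Finset.mem_filter.1 heB
    obtain ⟨n, hn, hw⟩ := exists_edgeWalk_of_reachable hk hr
    refine (min_le_right _ _).trans ((height_le_dist hX hl he).trans
      ((dist_le_of_edgeWalk hℓ0 hℓ hw).trans ?_))
    refine mul_le_mul_of_nonneg_right ?_ hℓ0
    have h1 : n ≤ 3 * A.card * k := hn.trans (by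
      rw [mul_assoc]
      omega)
    exact_mod_cast h1

end Bounds

end CellDecomposition

end

open CellDecomposition in
theorem mainTheorem5 (ℓ : ℝ) (k : ℕ) :
    ∃ c : ℝ, 0 < c ∧
      ∀ {X : Type*} [MetricSpace X] (Φ : X ≃ₜ Cylinder) (R L : ℝ), IsMetricCylinder Φ R L →
      ∀ {V D F : Type*} [Fintype V] [LinearOrder V] [Fintype D] [Fintype F]
        (G : CellDecomposition Φ V D F), G.IsAdmissible →
        (∀ d, curveLength (G.curve d) ≤ ENNReal.ofReal ℓ) →
        (∀ f : F, G.boundaryCount (Sum.inl f) ≤ k) →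
      ∀ S : Subgroup (MajoranaAlgebra V)ˣ, G.IsColorCode S →
        c * min R L ≤ (codeDistance S : ℝ) ∧ c * L ≤ evenDiameter G.pos S := by
  -- The factor `3 (k + 1)` bounds the number of edges, per unit of weight, of the walks used
  -- (`3 |A| k` in total); `max ℓ 1` and `k + 1` replace `ℓ` and `k` to keep the constant positive.
  have hM1 : (1 : ℝ) ≤ max ℓ 1 := le_max_right _ _
  set M : ℝ := max ℓ 1
  have hM0 : 0 ≤ M := zero_le_one.trans hM1
  have hK1 : (1 : ℝ) ≤ 3 * (k + 1) * M := by
    have : (1 : ℝ) ≤ 3 * (k + 1) := by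
      have : (0 : ℝ) ≤ k := Nat.cast_nonneg _
      linarith
    exact one_le_mul_of_one_le_of_one_le this hM1
  have hK0 : (0 : ℝ) < 3 * (k + 1) * M := zero_lt_one.trans_le hK1
  refine ⟨(3 * (k + 1) * M)⁻¹, inv_pos.2 hK0, ?_⟩
  intro X _ Φ R L hX V D F _ _ _ _ G hG hℓ hk S hS
  obtain ⟨-, C, hC, hSC⟩ := hS
  have hℓ' : ∀ d, curveLength (G.curve d) ≤ ENNReal.ofReal M := fun d =>
    (hℓ d).trans (ENNReal.ofReal_le_ofReal (le_max_left _ _))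
  have hc : G.IsConnected := isConnected_of_corners (exists_tail_eq hG.trivalent)
  have hV : Nonempty V := by
    obtain ⟨d, -⟩ := exists_left_eq hG (Sum.inr 0)
    exact ⟨G.tail d⟩
  have hE : Fintype.card V ≤ 2 * Fintype.card F := card_vertices_le (G := G) hG.trivalent
  have hL0 : 0 ≤ L := by
    obtain ⟨x, y, -, -, h⟩ := hX.height.1
    rw [h]
    exact dist_nonneg
  obtain ⟨P₀, hP₀, hP₀A⟩ := exists_isLogical_univ hG hC hSC
  constructor
  · have hne : {w | ∃ P A, IsLogical S P ∧ HasSupport P A ∧ w = A.card}.Nonempty :=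
      ⟨_, P₀, _, hP₀, hP₀A, rfl⟩
    obtain ⟨P, A, hP, hPA, hw⟩ := Nat.sInf_mem hne
    rw [codeDistance, hw, inv_mul_le_iff₀ hK0]
    have hA := faceSum_eq_zero_of_mem_codeCentralizer hG hC hSC hP.1 hPA
    have key : min R L ≤ 3 * A.card * k * M := by
      rcases Nat.even_or_odd A.card with heven | hodd
      · obtain ⟨x, hx, hx0⟩ := IsLogical.exists_vertexSum_eq hG hc hE hC hSC hP hPA
        refine min_le_of_odd_boundary_overlap hG hc hE hX hM0 hℓ' hk hA ?_
        have hsum := sum_vertexSum hG x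
        rw [hx, sum_supportVec, (ZMod.natCast_eq_zero_iff_even).2 heven] at hsum
        rw [← hx, faceSum_vertexSum_inr hG]
        intro h0
        rw [h0, zero_add] at hsum
        exact hx0 (Fin.forall_fin_two.2 ⟨h0, hsum.symm⟩)
      · exact (min_le_left _ _).trans (girth_le_of_odd_card hG hc hE hX hM0 hℓ' hk hA hodd)
    refine key.trans ?_
    have h1 : (0 : ℝ) ≤ 3 * A.card * M := by positivity
    calc 3 * (A.card : ℝ) * k * M = 3 * A.card * M * k := by ring
      _ ≤ 3 * A.card * M * (k + 1) := by gcongr; linarith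
      _ = 3 * (k + 1) * M * A.card := by ring
  · have hle : (3 * (k + 1) * M)⁻¹ * L ≤ L :=
      mul_le_of_le_one_left hL0 (inv_le_one_of_one_le₀ hK1)
    refine hle.trans (le_csInf ?_ ?_)
    · exact ⟨_, P₀, _, hP₀, hP₀A, by rw [Finset.card_univ]; exact hG.even_vertices, rfl⟩
    · rintro _ ⟨P, A, hP, hPA, heven, rfl⟩
      obtain ⟨x, hx, hx0⟩ := IsLogical.exists_vertexSum_eq hG hc hE hC hSC hP hPA
      have hsum := sum_vertexSum hG x
      rw [hx, sum_supportVec, (ZMod.natCast_eq_zero_iff_even).2 heven] at hsum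
      have heq : x (Sum.inr 0) = x (Sum.inr 1) := CharTwo.add_eq_zero.1 hsum.symm
      have h0 : x (Sum.inr 0) ≠ 0 := fun h => hx0 (Fin.forall_fin_two.2 ⟨h, heq ▸ h⟩)
      have h1 : x (Sum.inr 1) ≠ 0 := heq ▸ h0
      rw [← faceSum_vertexSum_inr hG x, hx] at h0 h1
      obtain ⟨d, hd, hdA⟩ := exists_boundary_vertex h0
      obtain ⟨e, he, heA⟩ := exists_boundary_vertex h1
      exact (height_le_dist hX hd he).trans (Metric.dist_le_diam_of_mem
        (A.finite_toSet.image _).isBounded ⟨_, hdA, rfl⟩ ⟨_, heA, rfl⟩)
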